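/- Let $R$ be an associative unital ring, and let all modules be right $R$-modules unless said otherwise. A module $P$ with a surjective homomorphism $p : P \to M$ is a projective cover of $M$ if $P$ is projective and $\ker p$ is superfluous in $P$; the ring $R$ is right perfect if every module has a projective cover. A module $M$ is flat Mittag-Leffler if it is flat and, for every family $(N_i)_{i \in I}$ of left $R$-modules, the canonical map $M \otimes_R \prod_{i} N_i \to \prod_{i} (M \otimes_R N_i)$ is injective; $\mathcal{FM}$ denotes the class of these modules. A module $M$ is $\aleph_1$-projective if there is a set $\mathcal S$ of countably generated projective submodules of $M$ that is closed under unions of countable well-ordered ascending chains and such that each countable subset of $M$ is contained in some member of $\mathcal S$. A Bass module for $\{R\}$ is a direct limit of a countably infinite direct system of modules all equal to $R$. For a class $\mathcal C$ of modules, a $\mathcal C$-precover of $M$ is a homomorphism $f : A \to M$ with $A \in \mathcal C$ through which each homomorphism $f' : A' \to M$ with $A' \in \mathcal C$ factors; $\mathcal C$ is precovering if every module has a $\mathcal C$-precover. A module $M$ is $\mathcal C$-filtered if there are an ordinal $\sigma$ and an increasing chain $(M_\alpha \mid \alpha \le \sigma)$ of submodules of $M$ with $M_0 = 0$, $M_\sigma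 = M$, $M_\alpha = \bigcup_{\beta < \alpha} M_\beta$ for all limit ordinals $\alpha \le \sigma$, and each $M_{\alpha+1}/M_\alpha$ ($\alpha < \sigma$) isomorphic to a module in $\mathcal C$; $\mathcal C$ is deconstructible if there is a set $\mathcal C' \subseteq \mathcal C$ such that $\mathcal C$ is the class of all $\mathcal C'$-filtered modules. **Theorem.** Assume that $R$ is not right perfect. Then no non-projective Bass module $B$ for $\{R\}$ has an $\aleph_1$-projective precover (that is, a precover with respect to the class of $\aleph_1$-projective modules), and none has an $\mathcal{FM}$-precover. In particular, the class $\mathcal{FM}$ of flat Mittag-Leffler modules is not precovering, and it is not deconstructible. -/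

import Mathlib

universe u v w

/-!
Throughout, `R` is an associative unital ring.  Right `R`-modules are modules over `Rᵐᵒᵖ`,
left `R`-modules are modules over `R`.
-/

namespace RightMod

open MulOpposite TensorProduct

section Perfect

variable {R : Type u} [Ring R]

/-- `p : P → M` is a projective cover of the right module `M`: `P` is projective, `p` is
surjective, and the kernel of `p` is a superfluous submodule of `P`. -/
def IsProjectiveCover {P : Type v} {M : Type w} [AddCommGroup P] [Module Rᵐᵒᵖ P]
    [AddCommGroup M] [Module Rᵐᵒᵖ M] (p : P →ₗ[Rᵐᵒᵖ] M) : Prop :=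
  Module.Projective Rᵐᵒᵖ P ∧ Function.Surjective p ∧
    ∀ N : Submodule Rᵐᵒᵖ P, N ⊔ LinearMap.ker p = ⊤ → N = ⊤

variable (R) in
/-- A ring is right perfect if every right module has a projective cover. -/
def IsRightPerfect : Prop :=
  ∀ M : ModuleCat.{u} Rᵐᵒᵖ, ∃ (P : ModuleCat.{u} Rᵐᵒᵖ) (p : P →ₗ[Rᵐᵒᵖ] M), IsProjectiveCover p

end Perfect

section Tensor

variable (R : Type u) [Ring R] (M : Type v) [AddCommGroup M] [Module Rᵐᵒᵖ M]

/-- The subgroup of `M ⊗[ℤ] N` generated by the elements `(m r) ⊗ n - m ⊗ (r n)`. -/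
def balancing (N : Type w) [AddCommGroup N] [Module R N] : AddSubgroup (M ⊗[ℤ] N) :=
  AddSubgroup.closure
    {t | ∃ (m : M) (r : R) (n : N), t = (op r • m) ⊗ₜ[ℤ] n - m ⊗ₜ[ℤ] (r • n)}

/-- The tensor product over `R` of a right `R`-module `M` and a left `R`-module `N`. -/
abbrev Tensor (N : Type w) [AddCommGroup N] [Module R N] : Type (max v w) :=
  (M ⊗[ℤ] N) ⧸ balancing R M N

variable {R}

/-- The homomorphism `M ⊗ N → M ⊗ N'` induced by a homomorphism `N → N'` of left modules. -/
def lTensor {N N' : Type w} [AddCommGroup N] [Module R N] [AddCommGroup N'] [Module R N']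
    (f : N →ₗ[R] N') : Tensor R M N →+ Tensor R M N' :=
  QuotientAddGroup.map (balancing R M N) (balancing R M N')
    (LinearMap.lTensor M (f.toAddMonoidHom.toIntLinearMap)).toAddMonoidHom <| by
      refine (AddSubgroup.closure_le _).2 ?_
      rintro _ ⟨m, r, n, rfl⟩
      exact AddSubgroup.subset_closure ⟨m, r, f n, by simp⟩

/-- The canonical map from `M ⊗ ∏ i, N i` to `∏ i, M ⊗ N i`. -/
def tensorPi {I : Type w} (N : I → Type w) [∀ i, AddCommGroup (N i)] [∀ i, Module R (N i)] :
    Tensor R M (∀ i, N i) →+ ∀ i, Tensor R M (N i) :=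
  AddMonoidHom.mk' (fun t i => lTensor M (LinearMap.proj (R := R) (φ := N) i) t)
    (fun s t => funext fun _ => map_add _ s t)

end Tensor

section FlatMittagLeffler

variable (R : Type u) [Ring R] (M : Type u) [AddCommGroup M] [Module Rᵐᵒᵖ M]

/-- The right module `M` is flat: `M ⊗ -` preserves injectivity of maps of left modules. -/
def IsFlat : Prop :=
  ∀ (N N' : Type u) [AddCommGroup N] [Module R N] [AddCommGroup N'] [Module R N']
    (f : N →ₗ[R] N'), Function.Injective f → Function.Injective (lTensor M f)

/-- The right module `M` is Mittag-Leffler: for every family of left modules, the canonical map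
`M ⊗ ∏ i, N i → ∏ i, M ⊗ N i` is injective. -/
def IsMittagLeffler : Prop :=
  ∀ (I : Type u) (N : I → Type u) [∀ i, AddCommGroup (N i)] [∀ i, Module R (N i)],
    Function.Injective (tensorPi (R := R) M N)

/-- `S` is an `ℵ₁`-dense system of submodules of `M` consisting of countably generated projective
modules.  (A countable well-ordered chain has a last term or a cofinal subchain of type `ω`, so
closure under unions of such chains is closure under unions of increasing sequences.) -/
structure IsAlephOneDenseProjective (S : Set (Submodule Rᵐᵒᵖ M)) : Prop where
  countablyGenerated : ∀ N ∈ S, ∃ X : Set M, X.Countable ∧ Submodule.span Rᵐᵒᵖ X = N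
  projective : ∀ N ∈ S, Module.Projective Rᵐᵒᵖ N
  iSup_mem : ∀ N : ℕ → Submodule Rᵐᵒᵖ M, Monotone N → (∀ n, N n ∈ S) → (⨆ n, N n) ∈ S
  exists_le : ∀ X : Set M, X.Countable → ∃ N ∈ S, X ⊆ N

end FlatMittagLeffler

section Classes

variable (R : Type u) [Ring R]

/-- The class of flat Mittag-Leffler right modules. -/
def FM : ModuleCat.{u} Rᵐᵒᵖ → Prop :=
  fun M => IsFlat R M ∧ IsMittagLeffler R M

/-- The class of `ℵ₁`-projective right modules. -/
def AlephOneProjective : ModuleCat.{u} Rᵐᵒᵖ → Prop :=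
  fun M => ∃ S : Set (Submodule Rᵐᵒᵖ M), IsAlephOneDenseProjective R M S

/-- A Bass module for `{R}`: a direct limit of a direct system, indexed by a countably infinite
directed poset, all of whose terms are the right module `R`. -/
def IsBass (B : ModuleCat.{u} Rᵐᵒᵖ) : Prop :=
  ∃ (I : Type) (_ : PartialOrder I) (_ : DecidableEq I) (f : ∀ i j : I, i ≤ j → R →ₗ[Rᵐᵒᵖ] R),
    Countable I ∧ Infinite I ∧ IsDirected I (· ≤ ·) ∧
    DirectedSystem (fun _ : I => R) (fun i j h => f i j h) ∧
    Nonempty (B ≃ₗ[Rᵐᵒᵖ] Module.DirectLimit (fun _ : I => R) f)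

variable {R}

/-- `f : A → M` is a `𝒞`-precover of `M`. -/
def IsPrecover (𝒞 : ModuleCat.{u} Rᵐᵒᵖ → Prop) {A M : ModuleCat.{u} Rᵐᵒᵖ}
    (f : A →ₗ[Rᵐᵒᵖ] M) : Prop :=
  𝒞 A ∧ ∀ A' : ModuleCat.{u} Rᵐᵒᵖ, 𝒞 A' → ∀ f' : A' →ₗ[Rᵐᵒᵖ] M,
    ∃ g : A' →ₗ[Rᵐᵒᵖ] A, f ∘ₗ g = f'

/-- The module `M` has a `𝒞`-precover. -/
def HasPrecover (𝒞 : ModuleCat.{u} Rᵐᵒᵖ → Prop) (M : ModuleCat.{u} Rᵐᵒᵖ) : Prop :=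
  ∃ (A : ModuleCat.{u} Rᵐᵒᵖ) (f : A →ₗ[Rᵐᵒᵖ] M), IsPrecover 𝒞 f

/-- The class `𝒞` is precovering. -/
def IsPrecovering (𝒞 : ModuleCat.{u} Rᵐᵒᵖ → Prop) : Prop :=
  ∀ M : ModuleCat.{u} Rᵐᵒᵖ, HasPrecover 𝒞 M

/-- `M` is filtered by the modules satisfying `𝒞`: it is the last term of a continuous increasing
chain of submodules indexed by the ordinals `≤ σ`, starting at `0`, whose consecutive factors are
isomorphic to modules satisfying `𝒞`. -/
def IsFiltered (𝒞 : ModuleCat.{u} Rᵐᵒᵖ → Prop) (M : ModuleCat.{u} Rᵐᵒᵖ) : Prop :=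
  ∃ (σ : Ordinal.{u}) (F : Ordinal.{u} → Submodule Rᵐᵒᵖ M),
    (∀ α β, α ≤ β → β ≤ σ → F α ≤ F β) ∧
    F 0 = ⊥ ∧
    (∀ α ≤ σ, Order.IsSuccLimit α → F α = ⨆ β : Set.Iio α, F β) ∧
    (∀ α < σ, ∃ C : ModuleCat.{u} Rᵐᵒᵖ, 𝒞 C ∧
      Nonempty ((F (Order.succ α) ⧸ (F α).submoduleOf (F (Order.succ α))) ≃ₗ[Rᵐᵒᵖ] C)) ∧
    F σ = ⊤

/-- The class `𝒞` is deconstructible: there is a set (not a proper class) of members of `𝒞`, here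
a family `D` indexed by a type in the universe of the modules, such that `𝒞` is the class of all
modules filtered by the members of the set. -/
def IsDeconstructible (𝒞 : ModuleCat.{u} Rᵐᵒᵖ → Prop) : Prop :=
  ∃ (ι : Type u) (D : ι → ModuleCat.{u} Rᵐᵒᵖ), (∀ i, 𝒞 (D i)) ∧
    ∀ M : ModuleCat.{u} Rᵐᵒᵖ, 𝒞 M ↔ IsFiltered (fun C => ∃ i, C = D i) M

end Classes

end RightMod

/-!
Let `B` be a Bass module. It is the direct limit of a sequence `R → R → R → ⋯`
(`IsBass.exists_isTelescope`). For an infinite set `K`, the *tree module* `L` is the submodule of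
the product of copies of `R` indexed by the finite sequences in `K` (the nodes of a tree) that is
generated by the standard basis vectors `e_t` and, for each branch `ν` of the tree and each `n`, by
a vector `x_{ν,n}` along `ν` with `x_{ν,n} = e_{ν|n} + a_n x_{ν,n+1}`, where the `a_n` define the
sequence. Modulo the nodes it is the direct sum of copies of `B`, one for each branch.

A submodule of `L` generated by countably many nodes and branches, with the nodes of these branches
among them, is free, by a unitriangular change of basis (`projective_subtreeModule`). So `L` is
`ℵ₁`-projective. If there are only finitely many branches, and almost all nodes lie on them, then
restricting coordinates is a retraction of `L` onto this submodule (`restrictTo_mem`), so that `L`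
is flat Mittag-Leffler.

*Precovers.* If `f : A → B` is a precover, then the homomorphisms `L → B` that are the projection on
the branches in a set `E` and zero elsewhere lift to `A`. For suitable `K` there are more sets `E`
of branches than maps from the nodes to `A`, so the lifts for some `E ≠ E'` agree on the nodes, and
their difference gives a section of `f` on a branch in which `E` and `E'` differ
(`exists_section_of_treeModule_lift`). So `B` is a direct summand of `A`. If `A` is
`ℵ₁`-projective, then `B` is a direct summand of a countably generated projective submodule of `A`.
If `A` is flat Mittag-Leffler, then so is `B`; testing this on cyclic left modules yields a chain
condition under which `B` is projective (`IsTelescope.stationary`,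
`IsTelescope.projective_of_stationary`).

*Existence of `B`.* If all Bass modules are projective, then the same chain condition is the
descending chain condition on principal left ideals of `R`, and so `R` is right perfect
(`isRightPerfect_of_stationary`): modulo the Jacobson radical `R` is semisimple, the radical is
T-nilpotent, and the projective cover of `M` is lifted from the decomposition of `M ⧸ M J` into
simple modules.

*Deconstructibility.* If the flat Mittag-Leffler modules are filtered by a set of them, then a large
tree module `L` has a filtration with small factors. A closure argument gives a submodule `N` of
`L` that contains the nodes, has fewer elements than there are branches, and for which
`(L ⧸ N) × N` has a filtration with the same factors (`isFiltered_quotient_prod`), hence is flat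
Mittag-Leffler. Some branch has zero projection on `N`, so `B` is a direct summand of `L ⧸ N` and
therefore projective.
-/

namespace RightMod

/-! ### Direct limits of sequences `A → A → ⋯` -/

section Telescope

variable {A : Type*} [Ring A]

theorem exists_comp_eq_of_ker_le {G E M : Type*} [AddCommGroup G] [Module A G] [AddCommGroup E]
    [Module A E] [AddCommGroup M] [Module A M] {φ : G →ₗ[A] E} {ψ : G →ₗ[A] M}
    (hφ : Function.Surjective φ) (hker : ∀ x, φ x = 0 → ψ x = 0) :
    ∃ g : E →ₗ[A] M, ∀ x, g (φ x) = ψ x := by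
  have hle : LinearMap.ker φ ≤ LinearMap.ker ψ := fun x hx => hker x hx
  refine ⟨(LinearMap.ker φ).liftQ ψ hle ∘ₗ (φ.quotKerEquivOfSurjective hφ).symm, fun x => ?_⟩
  have : (φ.quotKerEquivOfSurjective hφ).symm (φ x) = Submodule.Quotient.mk x := by
    rw [LinearEquiv.symm_apply_eq]
    simp
  rw [LinearMap.comp_apply, LinearEquiv.coe_coe, this, Submodule.liftQ_apply]

/-- The product `a n * a (n + 1) * ⋯ * a (n + j - 1)`. -/
def chainProd (a : ℕ → A) : ℕ → ℕ → A
  | _, 0 => 1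
  | n, j + 1 => a n * chainProd a (n + 1) j

@[simp] theorem chainProd_zero (a : ℕ → A) (n : ℕ) : chainProd a n 0 = 1 := rfl

theorem chainProd_succ (a : ℕ → A) (n j : ℕ) :
    chainProd a n (j + 1) = a n * chainProd a (n + 1) j := rfl

theorem chainProd_add (a : ℕ → A) (n i j : ℕ) :
    chainProd a n (i + j) = chainProd a n i * chainProd a (n + i) j := by
  induction i generalizing n with
  | zero => simp
  | succ i ih =>
    rw [show i + 1 + j = (i + j) + 1 by omega, chainProd_succ, ih, chainProd_succ, mul_assoc,
      show n + 1 + i = n + (i + 1) by omega]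

theorem chainProd_succ' (a : ℕ → A) (n j : ℕ) :
    chainProd a n (j + 1) = chainProd a n j * a (n + j) := by
  rw [chainProd_add, chainProd_succ]; simp

variable {B : Type*} [AddCommGroup B] [Module A B] {M : Type*} [AddCommGroup M] [Module A M]

/-- `B` is the direct limit of the sequence `A → A → A → ⋯` whose `n`-th map is `r ↦ r * a n`, and
`b n` is the image in `B` of the unit of the `n`-th term. -/
structure IsTelescope (a : ℕ → A) (b : ℕ → B) : Prop where
  eq_smul : ∀ n, b n = a n • b (n + 1)
  exists_eq : ∀ x, ∃ n, ∃ r : A, x = r • b n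
  exists_mul_eq_zero : ∀ n (r : A), r • b n = 0 → ∃ j, r * chainProd a n j = 0

theorem eq_chainProd_smul {a : ℕ → A} {s : ℕ → M} (hs : ∀ n, s n = a n • s (n + 1)) (n j : ℕ) :
    s n = chainProd a n j • s (n + j) := by
  induction j with
  | zero => simp
  | succ j ih => rw [chainProd_succ', mul_smul, ← add_assoc, ← hs, ← ih]

namespace IsTelescope

variable {a : ℕ → A} {b : ℕ → B}

/-- The universal property of the direct limit. -/
theorem exists_lift (h : IsTelescope a b) {s : ℕ → M} (hs : ∀ n, s n = a n • s (n + 1)) :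
    ∃ g : B →ₗ[A] M, ∀ n, g (b n) = s n := by
  let φ := Finsupp.linearCombination A b
  let ψ := Finsupp.linearCombination A s
  have key : ∀ x, ∃ m, ∃ r : A, φ x = r • b m ∧ ψ x = r • s m := by
    intro x
    induction x using Finsupp.induction_linear with
    | zero => exact ⟨0, 0, by simp, by simp⟩
    | add x y hx hy =>
      obtain ⟨m, r, h1, h2⟩ := hx
      obtain ⟨m', r', h1', h2'⟩ := hy
      refine ⟨m + m', r * chainProd a m m' + r' * chainProd a m' m, ?_, ?_⟩
      · rw [map_add, h1, h1', add_smul, mul_smul, mul_smul, ← eq_chainProd_smul h.eq_smul,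
          add_comm m m', ← eq_chainProd_smul h.eq_smul]
      · rw [map_add, h2, h2', add_smul, mul_smul, mul_smul, ← eq_chainProd_smul hs,
          add_comm m m', ← eq_chainProd_smul hs]
    | single n c => exact ⟨n, c, by simp [φ], by simp [ψ]⟩
  have hφ : Function.Surjective φ := fun x => by
    obtain ⟨n, r, rfl⟩ := h.exists_eq x
    exact ⟨Finsupp.single n r, by simp [φ]⟩
  obtain ⟨g, hg⟩ := exists_comp_eq_of_ker_le (ψ := ψ) hφ fun x hx => by
    obtain ⟨m, r, h1, h2⟩ := key x
    obtain ⟨j, hj⟩ := h.exists_mul_eq_zero m r (h1 ▸ hx)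
    rw [h2, eq_chainProd_smul hs m j, ← mul_smul, hj, zero_smul]
  exact ⟨g, fun n => by simpa [φ, ψ] using hg (Finsupp.single n 1)⟩

theorem hom_ext (h : IsTelescope a b) {f g : B →ₗ[A] M} (hfg : ∀ n, f (b n) = g (b n)) : f = g := by
  ext x
  obtain ⟨n, r, rfl⟩ := h.exists_eq x
  rw [map_smul, map_smul, hfg]

/-- If the right ideals generated by `a n` and by `a n * a (n + 1)` coincide for all `n`, then one
can choose lifts `w n` of `b (n + 1)` to the free module one after the other, correcting each by an
element of the kernel, such that the elements `a n • w n` define a section. -/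
theorem projective_of_mul_eq (h : IsTelescope a b) (c : ℕ → A)
    (hc : ∀ n, a n = a n * a (n + 1) * c n) : Module.Projective A B := by
  let u := Finsupp.linearCombination A b
  let e : ℕ → (ℕ →₀ A) := fun n => Finsupp.single n 1
  have hue : ∀ n, u (e n) = b n := fun n => by simp [u, e]
  let w : ℕ → (ℕ →₀ A) := fun n =>
    Nat.rec (e 1) (fun n x => e (n + 2) + c n • (x - a (n + 1) • e (n + 2))) n
  have hw : ∀ n, w (n + 1) = e (n + 2) + c n • (w n - a (n + 1) • e (n + 2)) := fun n => rfl
  have huw : ∀ n, u (w n) = b (n + 1) := by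
    intro n
    induction n with
    | zero => exact hue 1
    | succ n ih =>
      rw [hw, map_add, map_smul, map_sub, map_smul, ih, hue, ← h.eq_smul (n + 1)]
      simp
  obtain ⟨g, hg⟩ := h.exists_lift (s := fun n => a n • w n) (fun n => by
    rw [hw, smul_add (a (n + 1)), smul_add (a n), ← mul_smul, ← mul_smul, ← mul_smul,
      ← hc n, smul_sub, ← mul_smul]
    abel)
  refine Module.Projective.of_split g u (h.hom_ext fun n => ?_)
  rw [LinearMap.comp_apply, hg, map_smul, huw, ← h.eq_smul]
  rfl

/-- Passing to a cofinal subsequence. -/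
theorem subsequence (h : IsTelescope a b) (m d : ℕ → ℕ) (hm : ∀ i, m (i + 1) = m i + (d i + 1)) :
    IsTelescope (fun i => chainProd a (m i) (d i + 1)) (fun i => b (m i)) := by
  have hprod : ∀ j i, ∃ D, j ≤ D ∧ m (i + j) = m i + D ∧
      chainProd (fun i => chainProd a (m i) (d i + 1)) i j = chainProd a (m i) D := by
    intro j
    induction j with
    | zero => exact fun i => ⟨0, le_rfl, rfl, rfl⟩
    | succ j ih =>
      intro i
      obtain ⟨D, h1, h2, h3⟩ := ih (i + 1)
      refine ⟨d i + 1 + D, by omega, ?_, ?_⟩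
      · rw [show i + (j + 1) = i + 1 + j by omega, h2, hm]; omega
      · rw [chainProd_succ, h3, hm, ← chainProd_add]
  have hle : ∀ i, i ≤ m i := by
    intro i
    induction i with
    | zero => omega
    | succ i ih => rw [hm]; omega
  refine ⟨fun i => ?_, fun x => ?_, fun i r hr => ?_⟩
  · rw [hm]; exact eq_chainProd_smul h.eq_smul _ _
  · obtain ⟨n, r, rfl⟩ := h.exists_eq x
    refine ⟨n, r * chainProd a n (m n - n), ?_⟩
    rw [mul_smul]
    nth_rewrite 2 [← Nat.add_sub_cancel' (hle n)]
    rw [← eq_chainProd_smul h.eq_smul]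
  · obtain ⟨j, hj⟩ := h.exists_mul_eq_zero _ r hr
    obtain ⟨D, h1, -, h3⟩ := hprod j i
    refine ⟨j, ?_⟩
    rw [h3, ← Nat.add_sub_cancel' h1, chainProd_add, ← mul_assoc, hj, zero_mul]

/-- If for every `n` the descending chain of right ideals `chainProd a n k * A` becomes stationary,
then the direct limit is projective. -/
theorem projective_of_stationary (h : IsTelescope a b)
    (hstat : ∀ n, ∃ j, ∀ k, ∃ c, chainProd a n j = chainProd a n k * c) :
    Module.Projective A B := by
  choose d hd using hstat
  let m : ℕ → ℕ := fun i => Nat.rec 0 (fun _ x => x + (d x + 1)) i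
  have hm : ∀ i, m (i + 1) = m i + (d (m i) + 1) := fun i => rfl
  have : ∀ i, ∃ c, chainProd a (m i) (d (m i) + 1) =
      chainProd a (m i) (d (m i) + 1) * chainProd a (m (i + 1)) (d (m (i + 1)) + 1) * c := by
    intro i
    obtain ⟨c, hc⟩ := hd (m i) (d (m i) + 1 + (d (m (i + 1)) + 1))
    refine ⟨c * a (m i + d (m i)), ?_⟩
    rw [hm, ← chainProd_add, ← mul_assoc, ← hm, ← hc, chainProd_succ']
  choose c hc using this
  exact (h.subsequence m (fun i => d (m i)) hm).projective_of_mul_eq c hc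

end IsTelescope

end Telescope

/-! ### The tree module -/

section Tree

open Filter

variable {K : Type*}

/-- The node at height `n` of the branch `ν` of the tree of finite sequences in `K`. -/
def branch (ν : ℕ → K) (n : ℕ) : List K := (List.range n).map ν

@[simp] theorem length_branch (ν : ℕ → K) (n : ℕ) : (branch ν n).length = n := by simp [branch]

theorem branch_eq_branch_iff {ν μ : ℕ → K} {n : ℕ} :
    branch ν n = branch μ n ↔ ∀ i < n, ν i = μ i := by
  simp [branch]

theorem eventually_branch_ne {ν μ : ℕ → K} (h : ν ≠ μ) :
    ∀ᶠ n in atTop, branch ν n ≠ branch μ n := by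
  obtain ⟨i, hi⟩ := Function.ne_iff.1 h
  filter_upwards [eventually_gt_atTop i] with n hn heq
  exact hi (branch_eq_branch_iff.1 heq i hn)

variable {A : Type*} [Ring A]

open Classical in
/-- The basis vector of `List K → A` at the node `t`. -/
noncomputable def nodeVec (A : Type*) [Ring A] (t : List K) : List K → A := Pi.single t 1

open Classical in
/-- The vector supported on the nodes of height at least `n` of the branch `ν`, whose coordinate at
the node of height `i` is `a n * ⋯ * a (i - 1)`. -/
noncomputable def branchVec (a : ℕ → A) (ν : ℕ → K) (n : ℕ) : List K → A := fun t =>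
  if n ≤ t.length ∧ t = branch ν t.length then chainProd a n (t.length - n) else 0

theorem nodeVec_self (t : List K) : nodeVec A t t = 1 := by simp [nodeVec]

theorem nodeVec_of_ne {s t : List K} (h : s ≠ t) : nodeVec A t s = 0 := by
  simp [nodeVec, h]

variable (a : ℕ → A)

theorem branchVec_branch (ν : ℕ → K) (n j : ℕ) :
    branchVec a ν n (branch ν (n + j)) = chainProd a n j := by
  simp [branchVec]

theorem branchVec_of_lt {ν : ℕ → K} {n : ℕ} {t : List K} (h : t.length < n) :
    branchVec a ν n t = 0 := by
  simp [branchVec, h]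

theorem branchVec_of_ne {ν : ℕ → K} {n : ℕ} {t : List K} (h : t ≠ branch ν t.length) :
    branchVec a ν n t = 0 := by
  simp [branchVec, h]

theorem branchVec_eq (ν : ℕ → K) (n : ℕ) :
    branchVec a ν n = nodeVec A (branch ν n) + a n • branchVec a ν (n + 1) := by
  funext t
  simp only [Pi.add_apply, Pi.smul_apply, smul_eq_mul]
  by_cases ht : t = branch ν t.length
  · rcases lt_trichotomy t.length n with h | h | h
    · rw [branchVec_of_lt a h, branchVec_of_lt a (by omega), nodeVec_of_ne]
      · simp
      · rintro rfl; simp at h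
    · subst h
      have h1 := branchVec_branch a ν t.length 0
      rw [branchVec_of_lt a (Nat.lt_succ_self t.length), ← ht, nodeVec_self]
      rw [add_zero, ← ht] at h1
      simp [h1]
    · obtain ⟨j, hj⟩ := Nat.exists_eq_add_of_lt h
      rw [hj] at ht
      rw [nodeVec_of_ne (by rintro rfl; simp at h)]
      nth_rewrite 1 [ht]
      rw [ht, show n + j + 1 = n + (j + 1) by omega, branchVec_branch,
        show n + (j + 1) = n + 1 + j by omega, branchVec_branch, chainProd_succ, zero_add]
  · rw [branchVec_of_ne a ht, branchVec_of_ne a ht, nodeVec_of_ne]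
    · simp
    · rintro rfl; simp at ht

/-- The submodule of `List K → A` generated by the basis vectors at the nodes in `S` and by the
vectors along the branches in `X`. -/
noncomputable def subtreeModule (X : Set (ℕ → K)) (S : Set (List K)) : Submodule A (List K → A) :=
  Submodule.span A ({x | ∃ t ∈ S, nodeVec A t = x} ∪ {x | ∃ ν ∈ X, ∃ n, branchVec a ν n = x})

variable {a} in
theorem nodeVec_mem {X : Set (ℕ → K)} {S : Set (List K)} {t : List K} (ht : t ∈ S) :
    nodeVec A t ∈ subtreeModule a X S :=
  Submodule.subset_span (Or.inl ⟨t, ht, rfl⟩)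

variable {a} in
theorem branchVec_mem {X : Set (ℕ → K)} {S : Set (List K)} {ν : ℕ → K} (hν : ν ∈ X) (n : ℕ) :
    branchVec a ν n ∈ subtreeModule a X S :=
  Submodule.subset_span (Or.inr ⟨ν, hν, n, rfl⟩)

theorem subtreeModule_le {X : Set (ℕ → K)} {S : Set (List K)} {N : Submodule A (List K → A)}
    (h1 : ∀ t ∈ S, nodeVec A t ∈ N) (h2 : ∀ ν ∈ X, ∀ n, branchVec a ν n ∈ N) :
    subtreeModule a X S ≤ N := by
  refine Submodule.span_le.2 ?_
  rintro x (⟨t, ht, rfl⟩ | ⟨ν, hν, n, rfl⟩)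
  exacts [h1 t ht, h2 ν hν n]

theorem subtreeModule_mono {X X' : Set (ℕ → K)} {S S' : Set (List K)} (hX : X ⊆ X') (hS : S ⊆ S') :
    subtreeModule a X S ≤ subtreeModule a X' S' :=
  subtreeModule_le a (fun _ ht => nodeVec_mem (hS ht)) fun _ hν n => branchVec_mem (hX hν) n

theorem iSup_subtreeModule {ι : Sort*} (X : ι → Set (ℕ → K)) (S : ι → Set (List K)) :
    ⨆ i, subtreeModule a (X i) (S i) = subtreeModule a (⋃ i, X i) (⋃ i, S i) := by
  refine le_antisymm (iSup_le fun i => subtreeModule_mono a (Set.subset_iUnion X i)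
    (Set.subset_iUnion S i)) (subtreeModule_le a (fun t ht => ?_) fun ν hν n => ?_)
  · obtain ⟨i, hi⟩ := Set.mem_iUnion.1 ht
    exact Submodule.mem_iSup_of_mem i (nodeVec_mem hi)
  · obtain ⟨i, hi⟩ := Set.mem_iUnion.1 hν
    exact Submodule.mem_iSup_of_mem i (branchVec_mem hi n)

theorem exists_countable_span_eq_subtreeModule {X : Set (ℕ → K)} {S : Set (List K)}
    (hX : X.Countable) (hS : S.Countable) :
    ∃ Y : Set (List K → A), Y.Countable ∧ Submodule.span A Y = subtreeModule a X S := by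
  refine ⟨_, ?_, rfl⟩
  refine (hS.image (nodeVec A)).union ?_
  refine ((hX.prod (Set.countable_univ (α := ℕ))).image fun p => branchVec a p.1 p.2).mono ?_
  rintro x ⟨ν, hν, n, rfl⟩
  exact ⟨(ν, n), ⟨hν, trivial⟩, rfl⟩

/-- The set of nodes on the branches in `X`. -/
def nodesOf (X : Set (ℕ → K)) : Set (List K) := {t | ∃ ν ∈ X, t = branch ν t.length}

theorem branch_mem_nodesOf {X : Set (ℕ → K)} {ν : ℕ → K} (hν : ν ∈ X) (n : ℕ) :
    branch ν n ∈ nodesOf X := ⟨ν, hν, by simp⟩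

theorem countable_nodesOf {X : Set (ℕ → K)} (hX : X.Countable) : (nodesOf X).Countable := by
  refine ((hX.prod (Set.countable_univ (α := ℕ))).image fun p => branch p.1 p.2).mono ?_
  rintro t ⟨ν, hν, ht⟩
  exact ⟨(ν, t.length), ⟨hν, trivial⟩, ht.symm⟩

/-- Choose for every node on the branches in the countable set `X` the first branch, in some
enumeration of `X`, that passes through the node; along each branch this choice is eventually that
branch itself. -/
theorem exists_branch_choice [Nonempty K] {X : Set (ℕ → K)} (hX : X.Countable) :
    ∃ β : List K → ℕ → K, (∀ t ∈ nodesOf X, β t ∈ X ∧ t = branch (β t) t.length ∧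
      β (branch (β t) (t.length + 1)) = β t) ∧
      ∀ ν ∈ X, ∀ᶠ n in atTop, β (branch ν n) = ν := by
  obtain ⟨f, hf⟩ := Set.countable_iff_exists_injOn.1 hX
  have hex : ∀ t : List K, ∃ ν, t ∈ nodesOf X → (ν ∈ X ∧ t = branch ν t.length) ∧
      ∀ μ, μ ∈ X ∧ t = branch μ t.length → f ν ≤ f μ := by
    intro t
    by_cases ht : t ∈ nodesOf X
    · have hne : {ν | ν ∈ X ∧ t = branch ν t.length}.Nonempty := ht
      exact ⟨Function.argminOn f _ hne, fun _ => ⟨Function.argminOn_mem f _ hne,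
        fun μ hμ => Function.argminOn_le f _ hμ⟩⟩
    · exact ⟨fun _ => Classical.arbitrary K, fun h => absurd h ht⟩
  choose β hβ using hex
  have huniq : ∀ t ν, ν ∈ X → t = branch ν t.length →
      (∀ μ ∈ X, t = branch μ t.length → f ν ≤ f μ) → β t = ν := by
    intro t ν hν ht hmin
    obtain ⟨h1, h2⟩ := hβ t ⟨ν, hν, ht⟩
    exact hf h1.1 hν (le_antisymm (h2 ν ⟨hν, ht⟩) (hmin _ h1.1 h1.2))
  refine ⟨β, fun t ht => ?_, fun ν hν => ?_⟩
  · obtain ⟨⟨h1, h2⟩, h3⟩ := hβ t ht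
    refine ⟨h1, h2, huniq _ _ h1 (by simp) fun μ hμ h => h3 μ ⟨hμ, ?_⟩⟩
    nth_rewrite 1 [h2]
    simp only [length_branch] at h
    exact branch_eq_branch_iff.2 fun i hi => branch_eq_branch_iff.1 h i (by omega)
  · have hfin : {μ | μ ∈ X ∧ f μ < f ν}.Finite :=
      Set.Finite.of_finite_image ((Set.finite_Iio (f ν)).subset (by rintro _ ⟨μ, h, rfl⟩; exact h.2))
        (hf.mono fun μ h => h.1)
    have := (Filter.eventually_all_finite hfin).2 fun μ hμ =>
      eventually_branch_ne (ν := ν) (μ := μ) (by rintro rfl; exact lt_irrefl _ hμ.2)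
    filter_upwards [this] with n hn
    refine huniq _ _ hν (by simp) fun μ hμ h => ?_
    by_contra! hlt
    exact hn μ ⟨hμ, hlt⟩ (by simpa using h)

/-- Replacing, in the standard basis indexed by `S`, the vector at each node on a chosen branch by
the vector along that branch is a unitriangular change of basis, and gives a basis of
`subtreeModule a X S`. -/
theorem projective_subtreeModule [Nonempty K] {X : Set (ℕ → K)} {S : Set (List K)} (hX : X.Countable)
    (hS : nodesOf X ⊆ S) : Module.Projective A (subtreeModule a X S) := by
  classical
  obtain ⟨β, hβ, hβ'⟩ := exists_branch_choice hX
  let v : S → List K → A := fun t =>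
    if (t : List K) ∈ nodesOf X then branchVec a (β t) (t : List K).length else nodeVec A t
  have hv1 : ∀ t : S, (t : List K) ∈ nodesOf X → v t = branchVec a (β t) (t : List K).length :=
    fun t ht => if_pos ht
  have hv2 : ∀ t : S, (t : List K) ∉ nodesOf X → v t = nodeVec A t := fun t ht => if_neg ht
  have hself : ∀ t : S, v t t = 1 := by
    intro t
    by_cases ht : (t : List K) ∈ nodesOf X
    · rw [hv1 t ht]
      have := branchVec_branch a (β t) (t : List K).length 0
      rwa [add_zero, ← (hβ t ht).2.1] at this
    · rw [hv2 t ht, nodeVec_self]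
  have hzero : ∀ t : S, ∀ s : List K, s ≠ t → s.length ≤ (t : List K).length → v t s = 0 := by
    intro t s hne hle
    by_cases ht : (t : List K) ∈ nodesOf X
    · rw [hv1 t ht]
      rcases hle.lt_or_eq with h | h
      · exact branchVec_of_lt a h
      · refine branchVec_of_ne a fun hs => hne ?_
        rw [hs, h, ← (hβ t ht).2.1]
    · rw [hv2 t ht, nodeVec_of_ne hne]
  have hli : LinearIndependent A v := by
    rw [linearIndependent_iff]
    intro l hl
    by_contra hne
    -- at a shortest node of the support no other basis vector in the combination is nonzero
    obtain ⟨t, ht, hmin⟩ := Finset.exists_min_image l.support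
      (fun t : S => (t : List K).length) (Finsupp.support_nonempty_iff.2 hne)
    have h0 := congrFun hl (t : List K)
    rw [Finsupp.linearCombination_apply, Finsupp.sum, Finset.sum_apply, Finset.sum_eq_single t] at h0
    · simp only [Pi.smul_apply, hself, smul_eq_mul, mul_one, Pi.zero_apply] at h0
      exact Finsupp.mem_support_iff.1 ht h0
    · intro s hs hst
      rw [Pi.smul_apply, hzero s t (fun h => hst (Subtype.ext h.symm)) (hmin s hs), smul_zero]
    · exact fun h => absurd ht h
  have hspan : Submodule.span A (Set.range v) = subtreeModule a X S := by
    refine le_antisymm (Submodule.span_le.2 ?_) ?_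
    · rintro _ ⟨t, rfl⟩
      by_cases ht : (t : List K) ∈ nodesOf X
      · rw [hv1 t ht]; exact branchVec_mem (hβ t ht).1 _
      · rw [hv2 t ht]; exact nodeVec_mem t.2
    · have hmem : ∀ t : S, v t ∈ Submodule.span A (Set.range v) :=
        fun t => Submodule.subset_span ⟨t, rfl⟩
      have hnode : ∀ t ∈ S, nodeVec A t ∈ Submodule.span A (Set.range v) := by
        intro t htS
        by_cases ht : t ∈ nodesOf X
        · obtain ⟨h1, h2, h3⟩ := hβ t ht
          have ht' := branch_mem_nodesOf h1 (t.length + 1)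
          have e1 := hv1 ⟨t, htS⟩ ht
          have e2 := hv1 ⟨_, hS ht'⟩ ht'
          simp only [h3, length_branch] at e1 e2
          have := branchVec_eq a (β t) t.length
          rw [← h2, ← e1, ← e2, ← sub_eq_iff_eq_add] at this
          rw [← this]
          exact sub_mem (hmem _) (Submodule.smul_mem _ _ (hmem _))
        · have := hmem ⟨t, htS⟩
          rwa [hv2 ⟨t, htS⟩ ht] at this
      refine subtreeModule_le a hnode fun ν hν n => ?_
      -- far up the branch its vectors are in the basis; below they differ from them by nodes
      obtain ⟨N, hN⟩ := eventually_atTop.1 (hβ' ν hν)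
      rcases le_total n N with hnN | hnN
      · induction hnN using Nat.decreasingInduction with
        | self =>
          have := hmem ⟨branch ν N, hS (branch_mem_nodesOf hν N)⟩
          rw [hv1 _ (branch_mem_nodesOf hν N)] at this
          simpa only [hN N le_rfl, length_branch] using this
        | of_succ k hk ih =>
          rw [branchVec_eq]
          exact add_mem (hnode _ (hS (branch_mem_nodesOf hν k))) (Submodule.smul_mem _ _ ih)
      · have := hmem ⟨branch ν n, hS (branch_mem_nodesOf hν n)⟩
        rw [hv1 _ (branch_mem_nodesOf hν n)] at this
        simpa only [hN n hnN, length_branch] using this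
  rw [← hspan]
  have := Module.Free.of_basis (Module.Basis.span hli)
  infer_instance

/-- The module generated by all nodes and all branches of the tree of finite sequences in `K`.
Modulo the nodes it is a direct sum of copies of the direct limit of `A → A → ⋯`, one for each
branch. -/
noncomputable abbrev treeModule (K : Type*) : Submodule A (List K → A) :=
  subtreeModule a (Set.univ : Set (ℕ → K)) Set.univ

theorem exists_finite_subtreeModule {x : List K → A} (hx : x ∈ treeModule a K) :
    ∃ (X : Set (ℕ → K)) (S : Set (List K)), X.Finite ∧ S.Finite ∧ x ∈ subtreeModule a X S := by
  induction hx using Submodule.span_induction with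
  | mem x hx =>
    rcases hx with ⟨t, -, rfl⟩ | ⟨ν, -, n, rfl⟩
    · exact ⟨∅, {t}, Set.finite_empty, Set.finite_singleton t, nodeVec_mem (Set.mem_singleton t)⟩
    · exact ⟨{ν}, ∅, Set.finite_singleton ν, Set.finite_empty,
        branchVec_mem (Set.mem_singleton ν) n⟩
  | zero => exact ⟨∅, ∅, Set.finite_empty, Set.finite_empty, zero_mem _⟩
  | add x y _ _ hx hy =>
    obtain ⟨X, S, hX, hS, h⟩ := hx
    obtain ⟨X', S', hX', hS', h'⟩ := hy
    exact ⟨X ∪ X', S ∪ S', hX.union hX', hS.union hS', add_mem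
      (subtreeModule_mono a Set.subset_union_left Set.subset_union_left h)
      (subtreeModule_mono a Set.subset_union_right Set.subset_union_right h')⟩
  | smul c x _ hx =>
    obtain ⟨X, S, hX, hS, h⟩ := hx
    exact ⟨X, S, hX, hS, Submodule.smul_mem _ _ h⟩

theorem mem_span_nodeVec {S : Set (List K)} {X : Set (ℕ → K)} {x : List K → A}
    (hfin : x.support.Finite) (hS : x.support ⊆ S) : x ∈ subtreeModule a X S := by
  classical
  have : x = ∑ t ∈ hfin.toFinset, x t • nodeVec A t := by
    funext s
    rw [Finset.sum_apply]
    by_cases hs : x s = 0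
    · rw [hs, Finset.sum_eq_zero]
      intro t ht
      rw [Pi.smul_apply, nodeVec_of_ne, smul_zero]
      rintro rfl
      simp [hs] at ht
    · rw [Finset.sum_eq_single s]
      · simp [nodeVec_self]
      · intro t _ hts
        rw [Pi.smul_apply, nodeVec_of_ne hts.symm, smul_zero]
      · simp [hs]
  rw [this]
  exact sum_mem fun t ht => Submodule.smul_mem _ _ (nodeVec_mem (hS (by simpa using ht)))

/-- Restriction of a vector to the coordinates in `S`. -/
noncomputable def restrictTo (A : Type*) [Ring A] (S : Set (List K)) :
    (List K → A) →ₗ[A] (List K → A) where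
  toFun x := S.indicator x
  map_add' x y := Set.indicator_add S x y
  map_smul' c x := Set.indicator_const_smul S c x

theorem restrictTo_of_support_subset {S : Set (List K)} {x : List K → A} (h : x.support ⊆ S) :
    restrictTo A S x = x := Set.indicator_eq_self.2 h

theorem restrictTo_eq_self {X : Set (ℕ → K)} {S : Set (List K)} (hS : nodesOf X ⊆ S)
    {x : List K → A} (hx : x ∈ subtreeModule a X S) : restrictTo A S x = x := by
  refine subtreeModule_le a (N := LinearMap.eqLocus (restrictTo A S) LinearMap.id) ?_ ?_ hx
  · intro t ht
    refine restrictTo_of_support_subset fun s hs => ?_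
    by_contra hne
    exact hs (nodeVec_of_ne (by rintro rfl; exact hne ht))
  · intro ν hν n
    refine restrictTo_of_support_subset fun s hs => hS ⟨ν, hν, ?_⟩
    by_contra hne
    exact hs (branchVec_of_ne a hne)

/-- A branch outside the finite set `X` meets the branches in `X` in finitely many nodes only, so
that restriction to the nodes of `X` and finitely many other nodes maps the tree module into
`subtreeModule`, and by `restrictTo_eq_self` it is a retraction. -/
theorem restrictTo_mem {X : Set (ℕ → K)} {S : Set (List K)} (hX : X.Finite) (hS : S.Finite)
    {x : List K → A} (hx : x ∈ treeModule a K) :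
    restrictTo A (S ∪ nodesOf X) x ∈ subtreeModule a X (S ∪ nodesOf X) := by
  refine subtreeModule_le a (N := (subtreeModule a X (S ∪ nodesOf X)).comap
    (restrictTo A (S ∪ nodesOf X))) ?_ ?_ hx
  · intro t _
    refine mem_span_nodeVec a ((Set.finite_singleton t).subset fun s hs => ?_) ?_
    · by_contra hne
      refine hs ?_
      have : nodeVec A t s = 0 := nodeVec_of_ne hne
      simp [restrictTo, this]
    · exact Set.support_indicator_subset
  · intro ν _ n
    by_cases hν : ν ∈ X
    · rw [Submodule.mem_comap, restrictTo_eq_self a Set.subset_union_right (branchVec_mem hν n)]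
      exact branchVec_mem hν n
    · refine mem_span_nodeVec a ?_ Set.support_indicator_subset
      obtain ⟨m, hm⟩ := eventually_atTop.1 ((Filter.eventually_all_finite hX).2 fun μ hμ =>
        eventually_branch_ne (ν := ν) (μ := μ) (by rintro rfl; exact hν hμ))
      refine (hS.union ((Set.finite_Iio m).image (branch ν))).subset fun s hs => ?_
      have h1 : s ∈ S ∪ nodesOf X := Set.support_indicator_subset hs
      have h2 : s = branch ν s.length := by
        by_contra hne
        refine hs ?_
        have : branchVec a ν n s = 0 := branchVec_of_ne a hne
        simp [restrictTo, this]
      rcases h1 with h1 | ⟨μ, hμ, h1⟩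
      · exact Or.inl h1
      · refine Or.inr ⟨s.length, ?_, h2.symm⟩
        by_contra! hle
        exact hm s.length (by simpa using hle) μ hμ (h2.symm.trans h1)

end Tree

/-! ### Homomorphisms out of the tree module -/

section TreeHom

open Filter

variable {K : Type*} {A : Type*} [Ring A] (a : ℕ → A) {M : Type*} [AddCommGroup M] [Module A M]

/-- The basis vector at a node, as an element of the tree module. -/
noncomputable def treeNode (t : List K) : treeModule a K :=
  ⟨nodeVec A t, nodeVec_mem (Set.mem_univ t)⟩

/-- The vector along a branch, as an element of the tree module. -/
noncomputable def treeBranch (ν : ℕ → K) (n : ℕ) : treeModule a K :=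
  ⟨branchVec a ν n, branchVec_mem (Set.mem_univ ν) n⟩

theorem treeBranch_eq (ν : ℕ → K) (n : ℕ) :
    treeBranch a ν n = treeNode a (branch ν n) + a n • treeBranch a ν (n + 1) :=
  Subtype.ext (branchVec_eq a ν n)

theorem treeModule_le {N : Submodule A (treeModule a K)} (h1 : ∀ t, treeNode a t ∈ N)
    (h2 : ∀ ν n, treeBranch a ν n ∈ N) : N = ⊤ := by
  refine eq_top_iff.2 fun x _ => ?_
  have : treeModule a K ≤ N.map (treeModule a K).subtype :=
    subtreeModule_le a (fun t _ => ⟨_, h1 t, rfl⟩) fun ν _ n => ⟨_, h2 ν n, rfl⟩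
  obtain ⟨y, hy, hyx⟩ := this x.2
  rwa [← Subtype.ext (a1 := y) (a2 := x) hyx]

theorem branchVec_eq_chainProd_mul (ν : ℕ → K) (n j : ℕ) {t : List K} (ht : n + j ≤ t.length) :
    branchVec a ν n t = chainProd a n j * branchVec a ν (n + j) t := by
  by_cases h : t = branch ν t.length
  · obtain ⟨i, hi⟩ := Nat.exists_eq_add_of_le ht
    rw [hi] at h
    rw [h, branchVec_branch, add_assoc, branchVec_branch, chainProd_add]
  · rw [branchVec_of_ne a h, branchVec_of_ne a h, mul_zero]

/-- A homomorphism out of the tree module that vanishes on the nodes can be prescribed on each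
branch separately: modulo nodes, every linear relation between vectors along branches can be pushed
up to a height where the branches involved are distinct. -/
theorem exists_treeModule_hom {s : (ℕ → K) → ℕ → M} (hs : ∀ ν n, s ν n = a n • s ν (n + 1)) :
    ∃ h : treeModule a K →ₗ[A] M, (∀ t, h (treeNode a t) = 0) ∧
      ∀ ν n, h (treeBranch a ν n) = s ν n := by
  classical
  let φ := Finsupp.linearCombination A
    (Sum.elim (treeNode a) fun p : (ℕ → K) × ℕ => treeBranch a p.1 p.2)
  let ψ := Finsupp.linearCombination A
    (Sum.elim (fun _ : List K => (0 : M)) fun p : (ℕ → K) × ℕ => s p.1 p.2)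
  have hφ : Function.Surjective φ := LinearMap.range_eq_top.1 <| treeModule_le a
    (fun t => ⟨Finsupp.single (Sum.inl t) 1, by simp [φ]⟩)
    fun ν n => ⟨Finsupp.single (Sum.inr (ν, n)) 1, by simp [φ]⟩
  have key : ∀ x, ∃ F : Finset (ℕ → K), ∃ m₀, ∀ m ≥ m₀, ∃ c : (ℕ → K) →₀ A, c.support ⊆ F ∧
      (∀ t : List K, m ≤ t.length →
        (φ x : List K → A) t = Finsupp.linearCombination A (fun ν => branchVec a ν m t) c) ∧
      ψ x = Finsupp.linearCombination A (fun ν => s ν m) c := by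
    intro x
    induction x using Finsupp.induction_linear with
    | zero => exact ⟨∅, 0, fun m _ => ⟨0, by simp, by simp, by simp⟩⟩
    | add x y hx hy =>
      obtain ⟨F, m₀, h⟩ := hx
      obtain ⟨F', m₀', h'⟩ := hy
      refine ⟨F ∪ F', max m₀ m₀', fun m hm => ?_⟩
      obtain ⟨c, h0, h1, h2⟩ := h m (le_of_max_le_left hm)
      obtain ⟨c', h0', h1', h2'⟩ := h' m (le_of_max_le_right hm)
      refine ⟨c + c', Finsupp.support_add.trans (Finset.union_subset_union h0 h0'),
        fun t ht => ?_, ?_⟩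
      · rw [map_add, Submodule.coe_add, Pi.add_apply, h1 t ht, h1' t ht, map_add]
      · rw [map_add, h2, h2', map_add]
    | single i r =>
      rcases i with t | ⟨ν, n⟩
      · refine ⟨∅, t.length + 1, fun m hm => ⟨0, by simp, fun t' ht' => ?_, by simp [ψ]⟩⟩
        have : nodeVec A t t' = 0 := nodeVec_of_ne (by rintro rfl; omega)
        simp [φ, treeNode, this]
      · refine ⟨{ν}, n, fun m hm => ?_⟩
        obtain ⟨j, rfl⟩ := Nat.exists_eq_add_of_le hm
        refine ⟨Finsupp.single ν (r * chainProd a n j), Finsupp.support_single_subset,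
          fun t' ht' => ?_, ?_⟩
        · have : φ (Finsupp.single (Sum.inr (ν, n)) r) = r • treeBranch a ν n := by simp [φ]
          rw [this, Finsupp.linearCombination_single, smul_eq_mul, mul_assoc,
            ← branchVec_eq_chainProd_mul a ν n j ht']
          rfl
        · have : ψ (Finsupp.single (Sum.inr (ν, n)) r) = r • s ν n := by simp [ψ]
          rw [this, Finsupp.linearCombination_single, mul_smul, ← eq_chainProd_smul (hs ν)]
  obtain ⟨g, hg⟩ := exists_comp_eq_of_ker_le (ψ := ψ) hφ fun x hx => by
    obtain ⟨F, m₀, h⟩ := key x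
    obtain ⟨m, hm, hne⟩ := ((eventually_ge_atTop m₀).and ((Filter.eventually_all_finset F).2
      fun ν _ => (Filter.eventually_all_finset F).2 fun μ _ =>
        (eventually_imp_distrib_left.2 fun hne : ν ≠ μ => eventually_branch_ne hne))).exists
    obtain ⟨c, h0, h1, h2⟩ := h m hm
    -- the coordinate at the node of height `m` of a branch is its coefficient, since the branches
    -- involved are distinct at this height
    suffices c = 0 by rw [h2, this, map_zero]
    ext ν
    by_contra hν
    have hν' : ν ∈ c.support := Finsupp.mem_support_iff.2 hν
    have h3 := h1 (branch ν m) (by simp)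
    have h4 : branchVec a ν m (branch ν m) = 1 := branchVec_branch a ν m 0
    rw [hx, Finsupp.linearCombination_apply, Finsupp.sum, Finset.sum_eq_single_of_mem ν hν', h4] at h3
    · exact hν (by simpa using h3.symm)
    · intro μ hμ hμν
      rw [branchVec_of_ne a, smul_zero]
      simpa using hne ν (h0 hν') μ (h0 hμ) hμν.symm
  refine ⟨g, fun t => ?_, fun ν n => ?_⟩
  · simpa [φ, ψ] using hg (Finsupp.single (Sum.inl t) 1)
  · simpa [φ, ψ] using hg (Finsupp.single (Sum.inr (ν, n)) 1)

end TreeHom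

/-! ### Tensor products and flat Mittag-Leffler modules -/

open MulOpposite TensorProduct

section TensorLemmas

variable {R : Type u} [Ring R] {M : Type u} [AddCommGroup M] [Module Rᵐᵒᵖ M]
  {M' : Type u} [AddCommGroup M'] [Module Rᵐᵒᵖ M'] {N : Type u} [AddCommGroup N] [Module R N]
  {N' : Type u} [AddCommGroup N'] [Module R N']

variable (R) in
/-- The pure tensor `m ⊗ n` over `R`. -/
def tmul (m : M) (n : N) : Tensor R M N := QuotientAddGroup.mk (m ⊗ₜ[ℤ] n)

@[elab_as_elim]
theorem tensor_induction {C : Tensor R M N → Prop} (t : Tensor R M N)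
    (zero : C 0) (tmul : ∀ m n, C (tmul R m n)) (add : ∀ s t, C s → C t → C (s + t)) : C t := by
  obtain ⟨t, rfl⟩ := QuotientAddGroup.mk_surjective t
  induction t using TensorProduct.induction_on with
  | zero => exact zero
  | tmul m n => exact tmul m n
  | add s t hs ht => exact add _ _ hs ht

theorem add_tmul (m m' : M) (n : N) : tmul R (m + m') n = tmul R m n + tmul R m' n := by
  simp only [tmul, TensorProduct.add_tmul, QuotientAddGroup.mk_add]

theorem tmul_add (m : M) (n n' : N) : tmul R m (n + n') = tmul R m n + tmul R m n' := by
  simp only [tmul, TensorProduct.tmul_add, QuotientAddGroup.mk_add]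

@[simp] theorem tmul_zero (m : M) : tmul R m (0 : N) = 0 := by
  simp only [tmul, TensorProduct.tmul_zero, QuotientAddGroup.mk_zero]

@[simp] theorem zero_tmul (n : N) : tmul R (0 : M) n = 0 := by
  simp only [tmul, TensorProduct.zero_tmul, QuotientAddGroup.mk_zero]

theorem smul_tmul (c : Rᵐᵒᵖ) (m : M) (n : N) : tmul R (c • m) n = tmul R m (c.unop • n) := by
  refine (QuotientAddGroup.eq_iff_sub_mem).2 (AddSubgroup.subset_closure ⟨m, c.unop, n, rfl⟩)

/-- The homomorphism out of the tensor product given by a balanced biadditive map. -/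
def tensorLift {Q : Type*} [AddCommGroup Q] (f : M →+ N →+ Q)
    (hf : ∀ (c : Rᵐᵒᵖ) m n, f (c • m) n = f m (c.unop • n)) : Tensor R M N →+ Q :=
  QuotientAddGroup.lift (balancing R M N)
    (TensorProduct.liftAddHom f fun z m n => by simp) <| by
      refine (AddSubgroup.closure_le _).2 ?_
      rintro _ ⟨m, r, n, rfl⟩
      simp [hf]

/-- The homomorphism `M ⊗ N → M' ⊗ N` induced by a homomorphism `M → M'` of right modules. -/
def rTensor (φ : M →ₗ[Rᵐᵒᵖ] M') (N : Type u) [AddCommGroup N] [Module R N] :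
    Tensor R M N →+ Tensor R M' N :=
  QuotientAddGroup.map (balancing R M N) (balancing R M' N)
    (LinearMap.rTensor N (φ.toAddMonoidHom.toIntLinearMap)).toAddMonoidHom <| by
      refine (AddSubgroup.closure_le _).2 ?_
      rintro _ ⟨m, r, n, rfl⟩
      exact AddSubgroup.subset_closure ⟨φ m, r, n, by simp⟩

@[simp] theorem rTensor_tmul (φ : M →ₗ[Rᵐᵒᵖ] M') (m : M) (n : N) :
    rTensor φ N (tmul R m n) = tmul R (φ m) n := rfl

@[simp] theorem lTensor_tmul (f : N →ₗ[R] N') (m : M) (n : N) :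
    lTensor M f (tmul R m n) = tmul R m (f n) := rfl

theorem lTensor_rTensor (φ : M →ₗ[Rᵐᵒᵖ] M') (f : N →ₗ[R] N') (t : Tensor R M N) :
    lTensor M' f (rTensor φ N t) = rTensor φ N' (lTensor M f t) := by
  induction t using tensor_induction with
  | zero => simp only [map_zero]
  | tmul m n => rfl
  | add s t hs ht => simp only [map_add, hs, ht]

theorem exists_finset_rTensor_eq (t : Tensor R M N) : ∃ X : Finset M,
    ∀ (P : Type u) [AddCommGroup P] [Module Rᵐᵒᵖ P] (p : M →ₗ[Rᵐᵒᵖ] P) (i : P →ₗ[Rᵐᵒᵖ] M),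
      (∀ x ∈ X, i (p x) = x) → rTensor i N (rTensor p N t) = t := by
  classical
  induction t using tensor_induction with
  | zero => exact ⟨∅, fun P _ _ p i _ => by simp only [map_zero]⟩
  | tmul m n => exact ⟨{m}, fun P _ _ p i h => by simp [h m (Finset.mem_singleton_self m)]⟩
  | add s t hs ht =>
    obtain ⟨X, hX⟩ := hs
    obtain ⟨Y, hY⟩ := ht
    refine ⟨X ∪ Y, fun P _ _ p i h => ?_⟩
    rw [map_add, map_add, hX P p i fun x hx => h x (Finset.mem_union_left _ hx),
      hY P p i fun x hx => h x (Finset.mem_union_right _ hx)]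

variable (R M) in
/-- If each finite subset of `M` is fixed by some endomorphism of `M` that factors through a flat
Mittag-Leffler module, then `M` is flat Mittag-Leffler: an element of a kernel to be shown trivial
involves finitely many elements of `M`. -/
theorem FM_of_finite_retract (h : ∀ X : Finset M, ∃ (P : ModuleCat.{u} Rᵐᵒᵖ) (p : M →ₗ[Rᵐᵒᵖ] P)
    (i : P →ₗ[Rᵐᵒᵖ] M), FM R P ∧ ∀ x ∈ X, i (p x) = x) : FM R (ModuleCat.of Rᵐᵒᵖ M) := by
  constructor
  · intro N N' _ _ _ _ f hf
    refine (injective_iff_map_eq_zero _).2 fun (t : Tensor R M N) ht => ?_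
    obtain ⟨X, hX⟩ := exists_finset_rTensor_eq t
    obtain ⟨P, p, i, hP, hpi⟩ := h X
    have h0 : rTensor p N t = 0 := (injective_iff_map_eq_zero _).1 (hP.1 N N' f hf) _ <| by
      rw [lTensor_rTensor]
      exact (congrArg _ ht).trans (map_zero _)
    rw [← hX P p i hpi, h0, map_zero]
  · intro I N _ _
    refine (injective_iff_map_eq_zero _).2 fun (t : Tensor R M (∀ i, N i)) ht => ?_
    obtain ⟨X, hX⟩ := exists_finset_rTensor_eq t
    obtain ⟨P, p, i, hP, hpi⟩ := h X
    have h0 : rTensor p _ t = 0 := (injective_iff_map_eq_zero _).1 (hP.2 I N) _ <| by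
      funext j
      have : lTensor P (LinearMap.proj (R := R) (φ := N) j) (rTensor p _ t) = 0 := by
        rw [lTensor_rTensor]
        exact (congrArg _ (congrFun ht j)).trans (map_zero _)
      exact this
    rw [← hX P p i hpi, h0, map_zero]

theorem FM_of_retract {P : ModuleCat.{u} Rᵐᵒᵖ} (hP : FM R P) (p : M →ₗ[Rᵐᵒᵖ] P)
    (i : P →ₗ[Rᵐᵒᵖ] M) (h : ∀ x, i (p x) = x) : FM R (ModuleCat.of Rᵐᵒᵖ M) :=
  FM_of_finite_retract R M fun _ => ⟨P, p, i, hP, fun x _ => h x⟩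

section Free

variable (X : Type u)

/-- The isomorphism of `R^(X) ⊗ N` with `N^(X)`, in one direction. -/
noncomputable def freeTensor (N : Type u) [AddCommGroup N] [Module R N] :
    Tensor R (X →₀ Rᵐᵒᵖ) N →+ (X →₀ N) :=
  tensorLift
    (AddMonoidHom.mk' (fun m => AddMonoidHom.mk' (fun n => m.mapRange (fun c => c.unop • n) (by simp))
      fun n n' => by ext x; simp [smul_add]) fun m m' => by
        ext n x; simp [add_smul])
    fun c m n => by ext x; simp [mul_smul]

theorem freeTensor_tmul (m : X →₀ Rᵐᵒᵖ) (n : N) (x : X) :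
    freeTensor X N (tmul R m n) x = (m x).unop • n := rfl

theorem freeTensor_lTensor (f : N →ₗ[R] N') (t : Tensor R (X →₀ Rᵐᵒᵖ) N) (x : X) :
    freeTensor X N' (lTensor _ f t) x = f (freeTensor X N t x) := by
  induction t using tensor_induction with
  | zero => simp only [map_zero, Finsupp.zero_apply]
  | tmul m n => rw [lTensor_tmul, freeTensor_tmul, freeTensor_tmul, map_smul]
  | add s t hs ht => simp only [map_add, Finsupp.add_apply, hs, ht]

theorem freeTensor_injective : Function.Injective (freeTensor (R := R) X N) := by
  let ρ : (X →₀ N) →+ Tensor R (X →₀ Rᵐᵒᵖ) N := Finsupp.liftAddHom fun x =>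
    AddMonoidHom.mk' (fun n => tmul R (Finsupp.single x 1) n) fun n n' => tmul_add _ _ _
  have hρ : ∀ t, ρ (freeTensor X N t) = t := by
    intro t
    induction t using tensor_induction with
    | zero => simp only [map_zero]
    | add s t hs ht => simp only [map_add, hs, ht]
    | tmul m n =>
      induction m using Finsupp.induction_linear with
      | zero => simp
      | add m m' h h' => rw [add_tmul, map_add, map_add, h, h']
      | single x c =>
        have h1 : freeTensor X N (tmul R (Finsupp.single x c) n) = Finsupp.single x (c.unop • n) := by
          classical
          ext y
          rw [freeTensor_tmul, Finsupp.single_apply, Finsupp.single_apply]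
          split_ifs <;> simp
        have h2 : Finsupp.single x c = c • Finsupp.single x (1 : Rᵐᵒᵖ) := by simp
        rw [h1, h2, smul_tmul]
        simp [ρ]
  exact Function.LeftInverse.injective hρ

theorem FM_finsupp : FM R (ModuleCat.of Rᵐᵒᵖ (X →₀ Rᵐᵒᵖ)) := by
  constructor
  · intro N N' _ _ _ _ f hf
    refine (injective_iff_map_eq_zero _).2 fun (t : Tensor R (X →₀ Rᵐᵒᵖ) N) ht => ?_
    refine (injective_iff_map_eq_zero _).1 (freeTensor_injective X) _ (Finsupp.ext fun x => hf ?_)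
    rw [← freeTensor_lTensor, Finsupp.zero_apply, map_zero]
    exact (congrArg (fun s => freeTensor X N' s x) ht).trans (by simp)
  · intro I N _ _
    refine (injective_iff_map_eq_zero _).2 fun (t : Tensor R (X →₀ Rᵐᵒᵖ) (∀ i, N i)) ht => ?_
    refine (injective_iff_map_eq_zero _).1 (freeTensor_injective X) _
      (Finsupp.ext fun x => funext fun i => ?_)
    have := freeTensor_lTensor X (LinearMap.proj (R := R) (φ := N) i) t x
    rw [LinearMap.proj_apply] at this
    rw [← this, Finsupp.zero_apply, Pi.zero_apply]
    exact (congrArg (fun s => freeTensor X (N i) s x) (congrFun ht i)).trans (by simp)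

end Free

variable (M) in
theorem FM_of_projective [Module.Projective Rᵐᵒᵖ M] : FM R (ModuleCat.of Rᵐᵒᵖ M) := by
  obtain ⟨s, hs⟩ := Module.projective_def.1 (inferInstance : Module.Projective Rᵐᵒᵖ M)
  exact FM_of_retract (FM_finsupp M) s (Finsupp.linearCombination Rᵐᵒᵖ id) hs

section Stationary

/-- The group of additive maps from a left module `N` to `Q`, with its structure of a right
module. -/
def BalancedDual (_R N Q : Type*) [AddCommGroup N] [AddCommGroup Q] : Type _ := N →+ Q

instance (Q : Type*) [AddCommGroup Q] : AddCommGroup (BalancedDual R N Q) :=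
  inferInstanceAs (AddCommGroup (N →+ Q))

instance (Q : Type*) [AddCommGroup Q] : Module Rᵐᵒᵖ (BalancedDual R N Q) where
  smul c φ := AddMonoidHom.comp (show N →+ Q from φ) (DistribSMul.toAddMonoidHom N c.unop)
  one_smul φ := AddMonoidHom.ext fun y => congrArg (show N →+ Q from φ) (one_smul R y)
  mul_smul c d φ := AddMonoidHom.ext fun y =>
    congrArg (show N →+ Q from φ) (mul_smul d.unop c.unop y)
  smul_zero _ := rfl
  smul_add _ _ _ := rfl
  add_smul c d φ := AddMonoidHom.ext fun y =>
    (congrArg (show N →+ Q from φ) (add_smul c.unop d.unop y)).trans (map_add (show N →+ Q from φ) _ _)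
  zero_smul φ := AddMonoidHom.ext fun y =>
    (congrArg (show N →+ Q from φ) (zero_smul R y)).trans (map_zero (show N →+ Q from φ))

variable (R N) in
/-- The elements of `BalancedDual R N Q` as additive maps. -/
def BalancedDual.toHom (Q : Type*) [AddCommGroup Q] : BalancedDual R N Q →+ N →+ Q :=
  AddMonoidHom.id (N →+ Q)

open Filter

variable {a : ℕ → Rᵐᵒᵖ} {b : ℕ → M}

/-- Tensoring the direct limit with `N` gives the direct limit of the maps `y ↦ (a n).unop • y`
of `N`, so that an element that vanishes in it vanishes at a finite stage. This is read off from
sequences in `N` modulo those that are eventually zero. -/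
theorem IsTelescope.exists_smul_eq_zero (h : IsTelescope a b) {m : ℕ} {y : N}
    (hy : tmul R (b m) y = 0) : ∃ j, (chainProd a m j).unop • y = 0 := by
  let s : ℕ → BalancedDual R N (Germ (atTop : Filter ℕ) N) := fun n =>
    AddMonoidHom.mk' (fun y => ((fun k => (chainProd a n (k - n)).unop • y : ℕ → N) :
      Germ (atTop : Filter ℕ) N)) fun y y' => by simp only [smul_add]; rfl
  obtain ⟨g, hg⟩ := h.exists_lift (s := s) fun n => by
    refine AddMonoidHom.ext fun y => Germ.coe_eq.2 ?_
    filter_upwards [eventually_gt_atTop n] with k hk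
    obtain ⟨j, rfl⟩ := Nat.exists_eq_add_of_lt hk
    rw [show n + j + 1 - n = j + 1 by omega, chainProd_succ]
    change _ = (chainProd a (n + 1) (n + j + 1 - (n + 1))).unop • (a n).unop • y
    rw [show n + j + 1 - (n + 1) = j by omega, unop_mul, mul_smul]
  have h1 : BalancedDual.toHom R N _ (g (b m)) y = 0 := by
    rw [← map_zero (tensorLift ((BalancedDual.toHom R N _).comp g.toAddMonoidHom) fun c x y =>
      DFunLike.congr_fun (congrArg (BalancedDual.toHom R N _) (map_smul g c x)) y), ← hy]
    rfl
  rw [hg] at h1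
  obtain ⟨k, hk⟩ := (Germ.coe_eq.1 (h1 : ((_ : ℕ → N) : Germ (atTop : Filter ℕ) N) =
    ((0 : ℕ → N) : Germ (atTop : Filter ℕ) N))).exists
  exact ⟨k - m, hk⟩

/-- The Mittag-Leffler property, tested on the family of the cyclic left modules
`R ⧸ R (a (m + k - 1) ⋯ a m)`, yields the chain condition that makes the limit projective. -/
theorem IsTelescope.stationary (h : IsTelescope a b) (hM : IsMittagLeffler R M) (m : ℕ) :
    ∃ j, ∀ k, ∃ c, chainProd a m j = chainProd a m k * c := by
  let N : ULift.{u} ℕ → Type u := fun k => R ⧸ Ideal.span {(chainProd a m k.down).unop}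
  let y : ∀ k, N k := fun k => Submodule.Quotient.mk (1 : R)
  have h0 : tmul R (b m) y = 0 := by
    refine (injective_iff_map_eq_zero _).1 (hM _ N) _ (funext fun k => ?_)
    change tmul R (b m) (y k) = 0
    rw [eq_chainProd_smul h.eq_smul m k.down, smul_tmul]
    have : (chainProd a m k.down).unop • y k = 0 := by
      rw [← Submodule.Quotient.mk_smul, Submodule.Quotient.mk_eq_zero]
      simp
    rw [this, tmul_zero]
  obtain ⟨j, hj⟩ := h.exists_smul_eq_zero h0
  refine ⟨j, fun k => ?_⟩
  have hk := congrFun hj ⟨k⟩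
  rw [Pi.smul_apply, Pi.zero_apply, ← Submodule.Quotient.mk_smul, Submodule.Quotient.mk_eq_zero,
    smul_eq_mul, mul_one] at hk
  obtain ⟨c, hc⟩ := Ideal.mem_span_singleton'.1 hk
  exact ⟨op c, unop_injective (by simpa using hc.symm)⟩

/-- A flat Mittag-Leffler direct limit of a sequence `R → R → ⋯` is projective. -/
theorem IsTelescope.projective_of_isMittagLeffler (h : IsTelescope a b)
    (hM : IsMittagLeffler R M) : Module.Projective Rᵐᵒᵖ M :=
  h.projective_of_stationary (h.stationary hM)

end Stationary

end TensorLemmas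

/-! ### Bass's theorem on perfect rings -/

section Semisimple

variable {S : Type*} [Ring S]

/-- The descending chain condition on principal left ideals, for chains of generators. -/
def PrincipalDCC (S : Type*) [Ring S] : Prop :=
  ∀ x : ℕ → S, (∀ n, ∃ d, x (n + 1) = d * x n) → ∃ n, ∃ c, x n = c * x (n + 1)

theorem PrincipalDCC.exists_minimal (h : PrincipalDCC S) {C : Set S} (hC : C.Nonempty) :
    ∃ x ∈ C, ∀ y ∈ C, (∃ d, y = d * x) → ∃ c, x = c * y := by
  by_contra! hcon
  choose f hf1 hf2 hf3 using hcon
  obtain ⟨x₀, hx₀⟩ := hC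
  let z : ℕ → C := fun n => Nat.rec ⟨x₀, hx₀⟩ (fun _ x => ⟨f x.1 x.2, hf1 x.1 x.2⟩) n
  have hz : ∀ n, ∃ d : S, (z (n + 1)).1 = d * (z n).1 := fun n => hf2 (z n).1 (z n).2
  obtain ⟨n, c, hc⟩ := h (fun n => (z n).1) hz
  exact hf3 (z n).1 (z n).2 c hc

theorem PrincipalDCC.of_surjective {R : Type*} [Ring R] (h : PrincipalDCC R) (φ : R →+* S)
    (hφ : Function.Surjective φ) : PrincipalDCC S := by
  intro x hx
  choose d hd using hx
  obtain ⟨y₀, hy₀⟩ := hφ (x 0)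
  choose d' hd' using fun n => hφ (d n)
  let y : ℕ → R := fun n => Nat.rec y₀ (fun n z => d' n * z) n
  have hy : ∀ n, φ (y n) = x n := by
    intro n
    induction n with
    | zero => exact hy₀
    | succ n ih => rw [hd, ← ih, ← hd' n, ← map_mul]
  obtain ⟨n, c, hc⟩ := h y fun n => ⟨d' n, rfl⟩
  exact ⟨n, φ c, by rw [← hy, ← hy, ← map_mul, ← hc]⟩

/-- A nonzero principal left ideal that is minimal among these is generated by an idempotent, as it
has a maximal left ideal as a complement. -/
theorem exists_idempotent_of_minimal (hJ : Ring.jacobson S = ⊥) {x : S} (hx : x ≠ 0)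
    (hmin : ∀ y, y ≠ 0 → (∃ d, y = d * x) → ∃ c, x = c * y) :
    ∃ c, c * x ≠ 0 ∧ c * x * (c * x) = c * x := by
  have : ∃ m : Ideal S, m.IsMaximal ∧ x ∉ m := by
    by_contra! hcon
    have : x ∈ Ring.jacobson S := by
      rw [Ring.jacobson_eq_sInf_isMaximal]
      exact Submodule.mem_sInf.2 fun m hm => hcon m hm
    rw [hJ] at this
    exact hx this
  obtain ⟨m, hm, hxm⟩ := this
  obtain ⟨c, n, hn, hcn⟩ := Ideal.mem_span_singleton_sup.1
    (show (1 : S) ∈ Ideal.span {x} ⊔ m by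
      rw [sup_comm, hm.out.2 _ (left_lt_sup.2 fun h => hxm (h (Ideal.mem_span_singleton_self x)))]
      trivial)
  have hdisj : ∀ d, d * x ∈ m → d * x = 0 := by
    intro d hd
    by_contra hne
    obtain ⟨c', hc'⟩ := hmin (d * x) hne ⟨d, rfl⟩
    exact hxm (hc' ▸ m.mul_mem_left c' hd)
  refine ⟨c, fun h0 => hm.ne_top ((Ideal.eq_top_iff_one m).2 ?_), ?_⟩
  · rw [← hcn, h0, zero_add]; exact hn
  · have h1 : c * x - c * x * (c * x) = c * x * n := by
      rw [sub_eq_iff_eq_add', ← mul_add, hcn, mul_one]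
    have h2 := hdisj (c - c * x * c) (by
      rw [sub_mul, mul_assoc (c * x), h1]; exact m.mul_mem_left _ hn)
    rw [sub_mul, mul_assoc (c * x)] at h2
    exact (sub_eq_zero.1 h2).symm

/-- Among the idempotents `f` with `S (1 - f)` semisimple take one with `S f` minimal: if `f ≠ 0`,
then a minimal left ideal inside `S f` can be split off, so `f = 0`. -/
theorem isSemisimpleRing_of_principalDCC (h : PrincipalDCC S) (hJ : Ring.jacobson S = ⊥) :
    IsSemisimpleRing S := by
  have hsimple : ∀ x : S, (∀ y, y ≠ 0 → (∃ d, y = d * x) → ∃ c, x = c * y) → x ≠ 0 →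
      IsSemisimpleModule S (Ideal.span {x}) := by
    intro x hmin hx
    have : IsSimpleModule S (Ideal.span {x}) := by
      rw [isSimpleModule_iff_isAtom]
      refine ⟨by simpa using hx, fun I hI => ?_⟩
      by_contra hne
      obtain ⟨y, hy, hy0⟩ := Submodule.exists_mem_ne_zero_of_ne_bot hne
      obtain ⟨d, hd⟩ := Ideal.mem_span_singleton'.1 (hI.le hy)
      obtain ⟨c, hc⟩ := hmin y hy0 ⟨d, hd.symm⟩
      refine hI.not_ge ((Ideal.span_singleton_le_iff_mem I).2 ?_)
      rw [hc]; exact I.smul_mem c hy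
    infer_instance
  obtain ⟨f, ⟨hf, hfs⟩, hfmin⟩ := h.exists_minimal
    (C := {f | f * f = f ∧ IsSemisimpleModule S (Ideal.span {1 - f})})
    ⟨1, by simp, by
      rw [sub_self, Ideal.span_singleton_zero]
      exact .of_sSup_simples_eq_top (Subsingleton.elim _ _)⟩
  by_cases hf0 : f = 0
  · subst hf0
    rw [sub_zero, Ideal.span_singleton_one] at hfs
    exact hfs.congr Submodule.topEquiv.symm
  exfalso
  obtain ⟨x, ⟨hx0, q, hq⟩, hxmin⟩ := h.exists_minimal (C := {x | x ≠ 0 ∧ ∃ d, x = d * f})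
    ⟨f, hf0, 1, by simp⟩
  have hxmin' : ∀ y, y ≠ 0 → (∃ d, y = d * x) → ∃ c, x = c * y := by
    rintro y hy ⟨d, rfl⟩
    exact hxmin _ ⟨hy, d * q, by rw [mul_assoc, ← hq]⟩ ⟨d, rfl⟩
  obtain ⟨c, hc0, hc⟩ := exists_idempotent_of_minimal hJ hx0 hxmin'
  set e := c * x with he
  have hef : e * f = e := by rw [he, hq, mul_assoc, mul_assoc q, hf]
  have h1 : f * e * (f * e) = f * e := by
    rw [mul_assoc, ← mul_assoc e, hef, hc]
  have h2 : f * (f * e) = f * e := by rw [← mul_assoc, hf]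
  have h3 : f * e * f = f * e := by rw [mul_assoc, hef]
  have hne : f * e ≠ 0 := by
    intro h0
    apply hc0
    rw [← hc]
    nth_rewrite 1 [← hef]
    rw [mul_assoc, h0, mul_zero]
  have hidem : (f - f * e) * (f - f * e) = f - f * e := by
    rw [mul_sub, sub_mul, sub_mul, hf, h2, h3, h1]; abel
  obtain ⟨c', hc'⟩ := hfmin (f - f * e) ⟨hidem, by
    have hsup := IsSemisimpleModule.sup hfs (hsimple x hxmin' hx0)
    have hle : Ideal.span {1 - (f - f * e)} ≤ Ideal.span {1 - f} ⊔ Ideal.span {x} := by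
      rw [Ideal.span_singleton_le_iff_mem, sub_sub_eq_add_sub, add_sub_right_comm]
      refine Submodule.add_mem_sup (Ideal.mem_span_singleton_self _) ?_
      exact Ideal.mem_span_singleton'.2 ⟨f * c, by rw [he, mul_assoc]⟩
    exact IsSemisimpleModule.of_injective (Submodule.inclusion hle)
      (Submodule.inclusion_injective hle)⟩ ⟨f - f * e, by rw [sub_mul, hf, h3]⟩
  apply hne
  rw [← h2]
  nth_rewrite 1 [hc']
  rw [mul_assoc, sub_mul, h2, h1, sub_self, mul_zero]

end Semisimple

section Cover

variable {A : Type u} [Ring A] {J : Ideal A}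

/-- Nakayama's lemma for a left T-nilpotent ideal. -/
theorem eq_top_of_sup_smul_top {M : Type*} [AddCommGroup M] [Module A M]
    (hJ : ∀ a : ℕ → A, (∀ n, a n ∈ J) → ∃ n, chainProd a 0 n = 0) (N : Submodule A M)
    (h : N ⊔ J • (⊤ : Submodule A M) = ⊤) : N = ⊤ := by
  by_contra hN
  have hstep : ∀ a : {a : A // ∃ x : M, a • x ∉ N}, ∃ j ∈ J, ∃ x : M, (a.1 * j) • x ∉ N := by
    rintro ⟨a, x, hx⟩
    by_contra! hcon
    obtain ⟨y, hy, z, hz, hyz⟩ := Submodule.mem_sup.1 (h.ge (Submodule.mem_top (x := x)))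
    refine hx (hyz ▸ ?_)
    rw [smul_add]
    refine add_mem (N.smul_mem a hy) ?_
    refine Submodule.smul_induction_on hz (fun j hj w _ => ?_) fun u v hu hv => ?_
    · rw [← mul_smul]; exact hcon j hj w
    · rw [smul_add]; exact add_mem hu hv
  choose j hj hj' using hstep
  obtain ⟨x, hx⟩ : ∃ x, x ∉ N := by
    by_contra! hall
    exact hN (eq_top_iff.2 fun x _ => hall x)
  let z : ℕ → {a : A // ∃ x : M, a • x ∉ N} := fun n =>
    Nat.rec ⟨1, x, by rwa [one_smul]⟩ (fun _ a => ⟨a.1 * j a, hj' a⟩) n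
  have hz : ∀ n, (z n).1 = chainProd (fun n => j (z n)) 0 n := by
    intro n
    induction n with
    | zero => rfl
    | succ n ih => rw [chainProd_succ', ← ih, zero_add]
  obtain ⟨n, hn⟩ := hJ (fun n => j (z n)) fun n => hj _
  obtain ⟨y, hy⟩ := (z n).2
  rw [hz, hn, zero_smul] at hy
  exact hy N.zero_mem

theorem isSemisimpleModule_quotient_smul_top [J.IsTwoSided] (hss : IsSemisimpleModule A (A ⧸ J))
    (M : Type*) [AddCommGroup M] [Module A M] :
    IsSemisimpleModule A (M ⧸ J • (⊤ : Submodule A M)) := by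
  refine isSemisimpleModule_of_isSemisimpleModule_submodule'
    (p := fun m : M => Submodule.span A {(Submodule.Quotient.mk m : M ⧸ J • (⊤ : Submodule A M))})
    (fun m => ?_) (eq_top_iff.2 fun x _ => ?_)
  · have hle : J ≤ LinearMap.ker (LinearMap.toSpanSingleton A (M ⧸ J • (⊤ : Submodule A M))
        (Submodule.Quotient.mk m)) := by
      intro j hj
      rw [LinearMap.mem_ker, LinearMap.toSpanSingleton_apply, ← Submodule.Quotient.mk_smul,
        Submodule.Quotient.mk_eq_zero]
      exact Submodule.smul_mem_smul hj trivial
    have := IsSemisimpleModule.range (J.liftQ _ hle)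
    rwa [Submodule.range_liftQ, LinearMap.range_toSpanSingleton] at this
  · obtain ⟨m, rfl⟩ := Submodule.Quotient.mk_surjective _ x
    exact Submodule.mem_iSup_of_mem m (Submodule.mem_span_singleton_self _)

/-- A simple module `T` annihilated by `J` is a direct summand of `A ⧸ J`, hence given by an
idempotent of that ring; if this lifts to an idempotent `e`, then `A e` covers `T`. -/
theorem exists_cover_of_simple [J.IsTwoSided] (hss : IsSemisimpleModule A (A ⧸ J))
    (hnil : ∀ x ∈ J, IsNilpotent x) (T : Type*) [AddCommGroup T] [Module A T] [IsSimpleModule A T]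
    (hT : ∀ j ∈ J, ∀ t : T, j • t = 0) :
    ∃ P : Submodule A A, Module.Projective A P ∧ ∃ p : P →ₗ[A] T, Function.Surjective p ∧
      ∀ x, p x = 0 → x ∈ J • (⊤ : Submodule A P) := by
  have := IsSimpleModule.nontrivial A T
  obtain ⟨t, ht⟩ := exists_ne (0 : T)
  let q : (A ⧸ J) →ₗ[A] T := J.liftQ (LinearMap.toSpanSingleton A T t) fun j hj => hT j hj t
  have hq : ∀ x : A, q (Ideal.Quotient.mk J x) = x • t := fun x => rfl
  obtain ⟨s, hs⟩ := IsSemisimpleModule.lifting_property q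
    (fun y => by
      obtain ⟨x, hx⟩ := IsSimpleModule.toSpanSingleton_surjective A ht y
      exact ⟨Ideal.Quotient.mk J x, hx⟩) LinearMap.id
  have hqs : ∀ y, q (s y) = y := fun y => LinearMap.congr_fun hs y
  obtain ⟨e₁, he₁⟩ := Ideal.Quotient.mk_surjective (s t)
  have hsq : ∀ x : A, s (x • t) = Ideal.Quotient.mk J (x * e₁) := by
    intro x
    rw [map_smul, ← he₁, map_mul]
    rfl
  have he₁t : e₁ • t = t := by rw [← hq, he₁, hqs]
  have hidem : IsIdempotentElem (Ideal.Quotient.mk J e₁) := by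
    change Ideal.Quotient.mk J e₁ * Ideal.Quotient.mk J e₁ = _
    rw [← map_mul, ← hsq, he₁t, he₁]
  obtain ⟨e, he, hee₁⟩ := exists_isIdempotentElem_eq_of_ker_isNilpotent (Ideal.Quotient.mk J)
    (by rw [Ideal.mk_ker]; exact hnil) _ ⟨e₁, rfl⟩ hidem
  have het : e • t = t := by rw [← hq, hee₁, hq, he₁t]
  have hmul : ∀ x ∈ LinearMap.range (LinearMap.toSpanSingleton A A e), x * e = x := by
    rintro _ ⟨y, rfl⟩
    rw [LinearMap.toSpanSingleton_apply, smul_eq_mul, mul_assoc, he.eq]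
  refine ⟨LinearMap.range (LinearMap.toSpanSingleton A A e), ?_,
    LinearMap.toSpanSingleton A T t ∘ₗ Submodule.subtype _, fun y => ?_, ?_⟩
  · refine Module.Projective.of_split (Submodule.subtype _)
      (LinearMap.rangeRestrict (LinearMap.toSpanSingleton A A e)) ?_
    ext x
    exact hmul x x.2
  · obtain ⟨x, rfl⟩ := IsSimpleModule.toSpanSingleton_surjective A ht y
    refine ⟨⟨x * e, x, rfl⟩, ?_⟩
    change (x * e) • t = x • t
    rw [mul_smul, het]
  · rintro ⟨x, hx⟩ hx0
    replace hx0 : x • t = 0 := hx0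
    have hxJ : x ∈ J := by
      rw [← Ideal.Quotient.eq_zero_iff_mem, ← hmul x hx, map_mul, hee₁, ← map_mul, ← hsq, hx0,
        map_zero]
    have := Submodule.smul_mem_smul hxJ (Submodule.mem_top (x := (⟨e, 1, by simp⟩ :
      LinearMap.range (LinearMap.toSpanSingleton A A e))))
    convert this
    exact (hmul x hx).symm

/-- If `A ⧸ J` is semisimple and `J` is left T-nilpotent, then every module `M` has a projective
cover: `M ⧸ J M` is a direct sum of simple modules, and the direct sum of their covers maps onto
`M` by Nakayama's lemma. -/
theorem exists_projective_cover [J.IsTwoSided] (hss : IsSemisimpleModule A (A ⧸ J))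
    (hJ : ∀ a : ℕ → A, (∀ n, a n ∈ J) → ∃ n, chainProd a 0 n = 0)
    (M : Type u) [AddCommGroup M] [Module A M] :
    ∃ (P : ModuleCat.{u} A) (p : P →ₗ[A] M), Module.Projective A P ∧ Function.Surjective p ∧
      ∀ N : Submodule A P, N ⊔ LinearMap.ker p = ⊤ → N = ⊤ := by
  classical
  have hnil : ∀ x ∈ J, IsNilpotent x := by
    intro x hx
    obtain ⟨n, hn⟩ := hJ (fun _ => x) fun _ => hx
    refine ⟨n, hn ▸ ?_⟩
    generalize 0 = k
    clear hn
    induction n generalizing k with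
    | zero => simp
    | succ n ih => rw [pow_succ', chainProd_succ, ← ih]
  have := isSemisimpleModule_quotient_smul_top hss M
  obtain ⟨s, e, -, hsimple⟩ :=
    IsSemisimpleModule.exists_linearEquiv_dfinsupp A (M ⧸ J • (⊤ : Submodule A M))
  have hT : ∀ T : s, ∀ j ∈ J, ∀ t : T.1, j • t = 0 := by
    intro T j hj t
    refine Subtype.ext ?_
    obtain ⟨m, hm⟩ := Submodule.Quotient.mk_surjective _ t.1
    rw [Submodule.coe_smul, ← hm, ← Submodule.Quotient.mk_smul, Submodule.coe_zero,
      Submodule.Quotient.mk_eq_zero]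
    exact Submodule.smul_mem_smul hj trivial
  choose P hP p hp hker using fun T : s =>
    have := hsimple T
    exists_cover_of_simple hss hnil T.1 (hT T)
  let g : (Π₀ T : s, P T) →ₗ[A] Π₀ T : s, T.1 := DFinsupp.mapRange.linearMap p
  have hg : Function.Surjective g := (DFinsupp.mapRange_surjective _ (fun T => map_zero (p T))).2 hp
  have hgker : LinearMap.ker g ≤ J • ⊤ := by
    intro x hx
    rw [← DFinsupp.sum_single (f := x)]
    refine Submodule.sum_mem _ fun T _ => ?_
    have hxT : x T ∈ J • (⊤ : Submodule A (P T)) := hker T _ (DFunLike.congr_fun hx T)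
    refine Submodule.smul_induction_on (p := fun y => DFinsupp.single T y ∈ J • ⊤) hxT
      (fun j hj y _ => ?_) fun y z hy hz => ?_
    · rw [DFinsupp.single_smul]
      exact Submodule.smul_mem_smul hj trivial
    · rw [DFinsupp.single_add]
      exact add_mem hy hz
  obtain ⟨f, hf⟩ := Module.projective_lifting_property (J • (⊤ : Submodule A M)).mkQ
    (e.symm.toLinearMap ∘ₗ g) (Submodule.mkQ_surjective _)
  refine ⟨ModuleCat.of A (Π₀ T : s, P T), f, inferInstanceAs (Module.Projective A (Π₀ T : s, P T)),
    LinearMap.range_eq_top.1 (eq_top_of_sup_smul_top hJ _ (eq_top_iff.2 fun m _ => ?_)),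
    fun N hN => eq_top_of_sup_smul_top hJ N (eq_top_iff.2 (hN.ge.trans (sup_le_sup_left ?_ N)))⟩
  · obtain ⟨x, hx⟩ := hg (e (Submodule.Quotient.mk m))
    have hfx : (Submodule.Quotient.mk (f x) : M ⧸ J • (⊤ : Submodule A M)) =
        Submodule.Quotient.mk m := by
      have := LinearMap.congr_fun hf x
      rw [LinearMap.comp_apply, LinearMap.comp_apply, hx] at this
      simpa using this
    refine Submodule.mem_sup.2 ⟨f x, ⟨x, rfl⟩, m - f x, ?_, by abel⟩
    exact (Submodule.Quotient.eq _).1 hfx.symm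
  · refine le_trans (fun x hx => ?_) hgker
    have := LinearMap.congr_fun hf x
    rw [LinearMap.comp_apply, LinearMap.comp_apply, LinearMap.mem_ker.1 hx, map_zero] at this
    exact e.symm.injective (by simpa using this.symm)

end Cover

/-- Bass's theorem P, in the direction from the descending chain condition on principal left ideals
to the existence of projective covers of right modules. -/
theorem isRightPerfect_of_stationary {R : Type u} [Ring R]
    (h : ∀ a : ℕ → Rᵐᵒᵖ, ∃ j, ∀ k, ∃ c, chainProd a 0 j = chainProd a 0 k * c) :
    IsRightPerfect R := by
  have hdcc : PrincipalDCC R := by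
    intro x hx
    choose d hd using hx
    let a : ℕ → Rᵐᵒᵖ := fun n => Nat.rec (op (x 0)) (fun n _ => op (d n)) n
    have ha : ∀ n, chainProd a 0 (n + 1) = op (x n) := by
      intro n
      induction n with
      | zero => simp [chainProd_succ, a]
      | succ n ih => rw [chainProd_succ', ih, zero_add, hd, op_mul]
    obtain ⟨j, hj⟩ := h a
    rcases j with _ | n
    · obtain ⟨c, hc⟩ := hj 2
      refine ⟨0, x 0 * c.unop, ?_⟩
      rw [ha 1, chainProd_zero] at hc
      have := congrArg unop hc
      rw [unop_one, unop_mul, unop_op] at this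
      rw [mul_assoc, ← this, mul_one]
    · obtain ⟨c, hc⟩ := hj (n + 2)
      rw [ha, ha (n + 1)] at hc
      exact ⟨n, c.unop, congrArg unop hc⟩
  have hss : IsSemisimpleRing (R ⧸ Ring.jacobson R) :=
    isSemisimpleRing_of_principalDCC (hdcc.of_surjective _ Ideal.Quotient.mk_surjective)
      (Ring.jacobson_quotient_jacobson R)
  let φ : Rᵐᵒᵖ →+* (R ⧸ Ring.jacobson R)ᵐᵒᵖ := RingHom.op (Ideal.Quotient.mk (Ring.jacobson R))
  have hφ : Function.Surjective φ := fun y => by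
    obtain ⟨x, hx⟩ := Ideal.Quotient.mk_surjective y.unop
    exact ⟨op x, unop_injective hx⟩
  have hmem : ∀ x, x ∈ RingHom.ker φ → x.unop ∈ Ring.jacobson R := fun x hx =>
    Ideal.Quotient.eq_zero_iff_mem.1 (congrArg unop hx)
  have : RingHomSurjective φ := ⟨hφ⟩
  have hss' : IsSemisimpleModule Rᵐᵒᵖ (Rᵐᵒᵖ ⧸ RingHom.ker φ) := by
    refine (LinearMap.isSemisimpleModule_iff_of_bijective
      (Submodule.liftQ (RingHom.ker φ) φ.toSemilinearMap fun x hx => hx) ⟨?_, ?_⟩).2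
      (inferInstance : IsSemisimpleRing (R ⧸ Ring.jacobson R)ᵐᵒᵖ)
    · refine (injective_iff_map_eq_zero _).2 fun x hx => ?_
      obtain ⟨x, rfl⟩ := Submodule.Quotient.mk_surjective _ x
      exact (Submodule.Quotient.mk_eq_zero _).2 hx
    · intro y
      obtain ⟨x, rfl⟩ := hφ y
      exact ⟨Submodule.Quotient.mk x, rfl⟩
  refine fun M => exists_projective_cover (J := RingHom.ker φ) hss' (fun a ha => ?_) M
  obtain ⟨j, hj⟩ := h a
  obtain ⟨c, hc⟩ := hj (j + 1)
  refine ⟨j, ?_⟩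
  -- `1 - x` has a left inverse for `x` in the Jacobson radical
  have hinv : ∀ x ∈ Ring.jacobson R, ∃ y, y * (1 - x) = 1 := by
    intro x hx
    rw [← Ideal.mem_span_singleton']
    by_contra hne
    obtain ⟨m, hm, hle⟩ := Ideal.exists_le_maximal _ fun h => hne (h.ge Submodule.mem_top)
    refine hm.ne_top ((Ideal.eq_top_iff_one m).2 ?_)
    rw [← sub_add_cancel 1 x]
    exact add_mem (hle (Ideal.mem_span_singleton_self _)) (Ring.jacobson_le_of_isMaximal m hx)
  obtain ⟨y, hy⟩ := hinv (c.unop * (a j).unop)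
    ((Ring.jacobson R).mul_mem_left _ (hmem _ (ha j)))
  rw [chainProd_succ', zero_add] at hc
  have h0 : chainProd a 0 j * (1 - a j * c) = 0 := by
    rw [mul_sub, mul_one, ← mul_assoc, ← hc, sub_self]
  have hy' : (1 - a j * c) * op y = 1 := unop_injective (by simpa using hy)
  rw [← mul_one (chainProd a 0 j), ← hy', ← mul_assoc, h0, zero_mul]

/-! ### Tree modules and Bass modules over `R` -/

section TreeClasses

variable {R : Type u} [Ring R] (a : ℕ → Rᵐᵒᵖ) (K : Type u)

variable {a K} in
/-- The nodes and branches that occur in the elements of a set of elements of the tree module, when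
each element is written in terms of finitely many of them. -/
theorem exists_finite_choice : ∃ (X : treeModule a K → Set (ℕ → K))
    (S : treeModule a K → Set (List K)), (∀ x, (X x).Finite) ∧ (∀ x, (S x).Finite) ∧
      ∀ x, (x : List K → Rᵐᵒᵖ) ∈ subtreeModule a (X x) (S x) := by
  choose X S hX hS h using fun x : treeModule a K => exists_finite_subtreeModule a x.2
  exact ⟨X, S, hX, hS, h⟩

theorem alephOneProjective_treeModule [Nonempty K] :
    AlephOneProjective R (ModuleCat.of Rᵐᵒᵖ (treeModule a K)) := by
  have hinj : Function.Injective (treeModule a K).subtype := Subtype.val_injective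
  refine ⟨{N : Submodule Rᵐᵒᵖ (treeModule a K) | ∃ X S, X.Countable ∧ S.Countable ∧ nodesOf X ⊆ S ∧
    N.map (treeModule a K).subtype = subtreeModule a X S}, ?_, ?_, ?_, ?_⟩
  · rintro N ⟨X, S, hX, hS, -, hN⟩
    obtain ⟨Y, hY, hYN⟩ := exists_countable_span_eq_subtreeModule a hX hS
    refine ⟨Subtype.val ⁻¹' Y, hY.preimage_of_injOn Subtype.val_injective.injOn,
      Submodule.map_injective_of_injective hinj ?_⟩
    rw [Submodule.map_span, hN, ← hYN]
    congr 1
    refine Set.image_preimage_eq_of_subset fun y hy => ⟨⟨y, ?_⟩, rfl⟩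
    have : y ∈ subtreeModule a X S := hYN ▸ Submodule.subset_span hy
    exact subtreeModule_mono a (Set.subset_univ _) (Set.subset_univ _) this
  · rintro N ⟨X, S, hX, -, hXS, hN⟩
    have := projective_subtreeModule a hX hXS
    rw [← hN] at this
    exact Module.Projective.of_equiv (Submodule.equivMapOfInjective _ hinj N).symm
  · intro N _ hN
    choose X S hX hS hXS hNX using hN
    refine ⟨⋃ n, X n, ⋃ n, S n, Set.countable_iUnion hX, Set.countable_iUnion hS, ?_, ?_⟩
    · rintro t ⟨ν, hν, ht⟩
      obtain ⟨n, hn⟩ := Set.mem_iUnion.1 hν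
      exact Set.mem_iUnion.2 ⟨n, hXS n ⟨ν, hn, ht⟩⟩
    · rw [Submodule.map_iSup, ← iSup_subtreeModule]
      exact iSup_congr hNX
  · intro C hC
    obtain ⟨X, S, hX, hS, h⟩ := exists_finite_choice (a := a) (K := K)
    have hXC : (⋃ x ∈ C, X x).Countable := hC.biUnion fun x _ => (hX x).countable
    have hSC : (⋃ x ∈ C, S x).Countable := hC.biUnion fun x _ => (hS x).countable
    refine ⟨(subtreeModule a (⋃ x ∈ C, X x) ((⋃ x ∈ C, S x) ∪ nodesOf (⋃ x ∈ C, X x))).comap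
      (treeModule a K).subtype, ⟨_, _, hXC, hSC.union (countable_nodesOf hXC),
        Set.subset_union_right, ?_⟩, fun x hx => ?_⟩
    · rw [Submodule.map_comap_eq, Submodule.range_subtype]
      exact inf_eq_right.2 (subtreeModule_mono a (Set.subset_univ _) (Set.subset_univ _))
    · exact subtreeModule_mono a (Set.subset_biUnion_of_mem hx)
        ((Set.subset_biUnion_of_mem (u := S) hx).trans Set.subset_union_left) (h x)

theorem FM_treeModule [Nonempty K] : FM R (ModuleCat.of Rᵐᵒᵖ (treeModule a K)) := by
  refine FM_of_finite_retract R (treeModule a K) fun F => ?_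
  obtain ⟨X, S, hX, hS, h⟩ := exists_finite_choice (a := a) (K := K)
  have hXF : (⋃ x ∈ F, X x).Finite := F.finite_toSet.biUnion fun x _ => hX x
  have hSF : (⋃ x ∈ F, S x).Finite := F.finite_toSet.biUnion fun x _ => hS x
  let P := subtreeModule a (⋃ x ∈ F, X x) ((⋃ x ∈ F, S x) ∪ nodesOf (⋃ x ∈ F, X x))
  have hP : Module.Projective Rᵐᵒᵖ P :=
    projective_subtreeModule a hXF.countable Set.subset_union_right
  have hle : P ≤ treeModule a K := subtreeModule_mono a (Set.subset_univ _) (Set.subset_univ _)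
  refine ⟨ModuleCat.of Rᵐᵒᵖ P,
    ((restrictTo Rᵐᵒᵖ _).comp (treeModule a K).subtype).codRestrict P
      fun x => restrictTo_mem a hXF hSF x.2,
    Submodule.inclusion hle, FM_of_projective P, fun x hx => Subtype.ext ?_⟩
  refine restrictTo_eq_self a Set.subset_union_right (subtreeModule_mono a ?_ ?_ (h x))
  · exact Set.subset_biUnion_of_mem (u := X) hx
  · exact (Set.subset_biUnion_of_mem (u := S) hx).trans Set.subset_union_left

end TreeClasses

section Bass

variable {R : Type u} [Ring R]

theorem linearMap_eq_mul (f : R →ₗ[Rᵐᵒᵖ] R) (r : R) : f r = f 1 * r := by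
  have := f.map_smul (op r) 1
  rwa [op_smul_eq_mul, op_smul_eq_mul, one_mul] at this

theorem isTelescope_directLimit {I : Type*} [PartialOrder I] [DecidableEq I] [Nonempty I]
    [IsDirected I (· ≤ ·)] (f : ∀ i j : I, i ≤ j → R →ₗ[Rᵐᵒᵖ] R)
    [DirectedSystem (fun _ : I => R) (fun i j h => f i j h)] (i : ℕ → I) (hi : Monotone i)
    (hcof : ∀ x, ∃ n, x ≤ i n) :
    IsTelescope (fun n => op (f (i n) (i (n + 1)) (hi n.le_succ) 1))
      (fun n => Module.DirectLimit.of Rᵐᵒᵖ I (fun _ : I => R) f (i n) 1) := by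
  have hof : ∀ n (r : R), Module.DirectLimit.of Rᵐᵒᵖ I (fun _ : I => R) f (i n) r =
      op r • Module.DirectLimit.of Rᵐᵒᵖ I (fun _ : I => R) f (i n) 1 := fun n r => by
    rw [← map_smul, op_smul_eq_mul, one_mul]
  have hf : ∀ m j (r : R), f (i m) (i (m + j)) (hi (m.le_add_right j)) r =
      (chainProd (fun n => op (f (i n) (i (n + 1)) (hi n.le_succ) 1)) m j).unop * r := by
    intro m j r
    induction j with
    | zero =>
      rw [chainProd_zero, unop_one, one_mul]
      exact DirectedSystem.map_self (f := fun i j h => f i j h) r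
    | succ j ih =>
      rw [chainProd_succ', unop_mul, mul_assoc, ← ih, unop_op, ← linearMap_eq_mul]
      exact (DirectedSystem.map_map (f := fun i j h => f i j h) _ _ r).symm
  refine ⟨fun n => ?_, fun x => ?_, fun n r hr => ?_⟩
  · rw [← hof, Module.DirectLimit.of_f]
  · obtain ⟨j, r, rfl⟩ := Module.DirectLimit.exists_of x
    obtain ⟨n, hn⟩ := hcof j
    exact ⟨n, op (f j (i n) hn r), by rw [← hof, Module.DirectLimit.of_f]⟩
  · have hr' : Module.DirectLimit.of Rᵐᵒᵖ I (fun _ : I => R) f (i n) r.unop = 0 := by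
      rw [hof]; exact hr
    obtain ⟨j, hj, h0⟩ := Module.DirectLimit.of.zero_exact hr'
    obtain ⟨k, hk⟩ := hcof j
    refine ⟨k, unop_injective ?_⟩
    rw [unop_mul, ← hf, unop_zero,
      ← DirectedSystem.map_map (f := fun i j h => f i j h) hj (hk.trans (hi (Nat.le_add_left k n)))]
    rw [h0, map_zero]

theorem IsTelescope.map {A B C : Type*} [Ring A] [AddCommGroup B] [Module A B] [AddCommGroup C]
    [Module A C] {a : ℕ → A} {b : ℕ → B} (h : IsTelescope a b) (e : B ≃ₗ[A] C) :
    IsTelescope a fun n => e (b n) := by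
  refine ⟨fun n => ?_, fun x => ?_, fun n r hr => ?_⟩
  · rw [← map_smul, ← h.eq_smul]
  · obtain ⟨n, r, hr⟩ := h.exists_eq (e.symm x)
    exact ⟨n, r, by rw [← map_smul, ← hr, e.apply_symm_apply]⟩
  · rw [← map_smul, e.map_eq_zero_iff] at hr
    exact h.exists_mul_eq_zero n r hr

/-- A countable directed poset has a cofinal sequence, so that a Bass module is the direct limit of
a sequence `R → R → R → ⋯`. -/
theorem IsBass.exists_isTelescope {B : ModuleCat.{u} Rᵐᵒᵖ} (hB : IsBass R B) :
    ∃ (a : ℕ → Rᵐᵒᵖ) (b : ℕ → B), IsTelescope a b := by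
  obtain ⟨I, _, _, f, _, _, hdir, _, ⟨e⟩⟩ := hB
  have := Encodable.ofCountable I
  have : Inhabited I := Classical.inhabited_of_nonempty inferInstance
  have hd : Directed (· ≤ ·) (id : I → I) := fun x y => hdir.directed x y
  have h := isTelescope_directLimit f (hd.sequence id) hd.sequence_mono fun x =>
    ⟨_, hd.le_sequence x⟩
  exact ⟨_, _, h.map e.symm⟩

/-- Left multiplication, as an endomorphism of the right module `R`. -/
def mulLeftHom (c : R) : R →ₗ[Rᵐᵒᵖ] R where
  toFun r := c * r
  map_add' := mul_add c
  map_smul' m r := mul_smul_comm m c r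

theorem exists_isBass_isTelescope (a : ℕ → Rᵐᵒᵖ) :
    ∃ (B : ModuleCat.{u} Rᵐᵒᵖ) (b : ℕ → B), IsBass R B ∧ IsTelescope a b := by
  let f : ∀ i j : ℕ, i ≤ j → R →ₗ[Rᵐᵒᵖ] R := fun i j _ => mulLeftHom (chainProd a i (j - i)).unop
  have hf : ∀ i j h r, f i j h r = (chainProd a i (j - i)).unop * r := fun _ _ _ _ => rfl
  have hsys : DirectedSystem (fun _ : ℕ => R) (fun i j h => f i j h) := by
    refine ⟨fun i r => ?_, fun k j i hij hjk r => ?_⟩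
    · simp [hf]
    · obtain ⟨p, rfl⟩ := Nat.exists_eq_add_of_le hij
      obtain ⟨q, rfl⟩ := Nat.exists_eq_add_of_le hjk
      rw [hf _ _ hjk, hf _ _ hij, hf _ _ (hij.trans hjk),
        show i + p + q - i = p + q by omega, chainProd_add, unop_mul,
        show i + p + q - (i + p) = q by omega, show i + p - i = p by omega, mul_assoc]
  refine ⟨ModuleCat.of Rᵐᵒᵖ (Module.DirectLimit (fun _ : ℕ => R) f),
    fun n : ℕ => Module.DirectLimit.of Rᵐᵒᵖ ℕ (fun _ : ℕ => R) f n 1,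
    ⟨ℕ, inferInstance, inferInstance, f, inferInstance, inferInstance, inferInstance, hsys,
      ⟨LinearEquiv.refl _ _⟩⟩, ?_⟩
  · have := isTelescope_directLimit f id monotone_id fun n => ⟨n, le_rfl⟩
    convert this using 2 with n
    · simp [hf, chainProd_succ]
    · rfl

theorem exists_isBass_not_projective (hR : ¬ IsRightPerfect R) :
    ∃ B : ModuleCat.{u} Rᵐᵒᵖ, IsBass R B ∧ ¬ Module.Projective Rᵐᵒᵖ B := by
  by_contra! hall
  refine hR (isRightPerfect_of_stationary fun a => ?_)
  obtain ⟨B, b, hB, hb⟩ := exists_isBass_isTelescope a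
  have := hall B hB
  exact hb.stationary (FM_of_projective B).2 0

end Bass

/-! ### Bass modules have no precovers -/

open Cardinal

section Cardinality

/-- The iterated power sets of `X`. -/
def powerTower (X : Type u) : ℕ → Type u
  | 0 => X
  | n + 1 => Set (powerTower X n)

/-- There are arbitrarily large sets `K` with `2 ^ #K ≤ #K ^ ℵ₀`: the supremum of the iterated
power sets of `X` is one, as a subset of `K` is determined by its traces on them. -/
theorem exists_set_embedding_seq (X : Type u) [Nonempty X] : ∃ K : Type u, ℵ₀ ≤ #K ∧ #X ≤ #K ∧
    #(Set K) ≤ #(ℕ → K) := by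
  have hne : ∀ n, Nonempty (powerTower X n) := by
    rintro (_ | n)
    · exact ‹Nonempty X›
    · exact inferInstanceAs (Nonempty (Set (powerTower X n)))
  refine ⟨Σ n, powerTower X n, ?_, ?_, ?_⟩
  · rw [aleph0_le_mk_iff]
    exact Infinite.of_injective (fun n => ⟨n, (hne n).some⟩) fun m n h => congrArg Sigma.fst h
  · exact mk_le_of_injective (f := fun x => ⟨0, x⟩) fun x y h => eq_of_heq (Sigma.mk.inj h).2
  · refine mk_le_of_injective (f := fun E n => ⟨n + 1, {x | (⟨n, x⟩ : Σ n, powerTower X n) ∈ E}⟩)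
      fun E E' h => ?_
    ext ⟨n, x⟩
    have := eq_of_heq (Sigma.mk.inj (congrFun h n)).2
    exact Set.ext_iff.1 this x

end Cardinality

section NoPrecover

variable {R : Type u} [Ring R] {a : ℕ → Rᵐᵒᵖ}

/-- A homomorphism onto the direct limit `B` of the sequence given by `a` through which all
homomorphisms from the tree modules factor splits. For a set `E` of branches let `h E` be the
homomorphism from the tree module to `B` that is the projection on the branches in `E` and zero on
the nodes and on the other branches. If `K` is chosen as in `exists_set_embedding_seq`, there are
more such sets than maps from the nodes to `A`; so for some `E ≠ E'` the lifts of `h E` and `h E'`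
agree on all nodes, and their difference induces a section on a branch in which `E` and `E'`
differ. -/
theorem exists_section_of_treeModule_lift {A B : ModuleCat.{u} Rᵐᵒᵖ} {b : ℕ → B}
    (hb : IsTelescope a b) (f : A →ₗ[Rᵐᵒᵖ] B)
    (hf : ∀ K : Type u, Nonempty K → ∀ f' : treeModule a K →ₗ[Rᵐᵒᵖ] B,
      ∃ g : treeModule a K →ₗ[Rᵐᵒᵖ] A, f ∘ₗ g = f') :
    ∃ g : B →ₗ[Rᵐᵒᵖ] A, ∀ x, f (g x) = x := by
  classical
  obtain ⟨K, hK, hAK, hKK⟩ := exists_set_embedding_seq A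
  have hKne : Nonempty K := by
    rw [← mk_ne_zero_iff]; exact (aleph0_pos.trans_le hK).ne'
  have hh : ∀ E : Set (ℕ → K), ∃ h : treeModule a K →ₗ[Rᵐᵒᵖ] B, (∀ t, h (treeNode a t) = 0) ∧
      ∀ ν n, h (treeBranch a ν n) = if ν ∈ E then b n else 0 := fun E =>
    exists_treeModule_hom a (s := fun ν n => if ν ∈ E then b n else 0) fun ν n => by
      split_ifs
      · exact hb.eq_smul n
      · simp
  choose h hnode hbranch using hh
  choose g hg using fun E => hf K hKne (h E)
  have hg' : ∀ E x, f (g E x) = h E x := fun E x => LinearMap.congr_fun (hg E) x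
  have key : ∀ E E', (∀ t, g E (treeNode a t) = g E' (treeNode a t)) → ∀ ν ∈ E, ν ∉ E' →
      ∃ g : B →ₗ[Rᵐᵒᵖ] A, ∀ x, f (g x) = x := by
    intro E E' hEE' ν hν hν'
    obtain ⟨q, hq⟩ := hb.exists_lift (s := fun n => (g E - g E') (treeBranch a ν n)) fun n => by
      rw [treeBranch_eq, map_add, map_smul, LinearMap.sub_apply, hEE', sub_self, zero_add]
    refine ⟨q, fun x => LinearMap.congr_fun (f := f ∘ₗ q) (g := LinearMap.id)
      (hb.hom_ext fun n => ?_) x⟩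
    rw [LinearMap.comp_apply, hq, LinearMap.sub_apply, map_sub, hg', hg', hbranch, hbranch,
      if_pos hν, if_neg hν', sub_zero, LinearMap.id_apply]
  have hninj : ¬ Function.Injective fun (E : Set (ℕ → K)) (t : List K) => g E (treeNode a t) := by
    intro hinj
    refine (cantor #(ℕ → K)).not_ge ?_
    calc 2 ^ #(ℕ → K) = #(Set (ℕ → K)) := (mk_set).symm
      _ ≤ #(List K → A) := mk_le_of_injective hinj
      _ = #A ^ #K := by
        have := aleph0_le_mk_iff.1 hK
        rw [← power_def, mk_list_eq_mk]
      _ ≤ #K ^ #K := power_le_power_right hAK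
      _ = #(Set K) := by rw [power_self_eq hK, mk_set]
      _ ≤ #(ℕ → K) := hKK
  obtain ⟨E, E', hEE', hne⟩ := Function.not_injective_iff.1 hninj
  by_contra hcon
  refine hne (Set.Subset.antisymm (fun ν hν => ?_) fun ν hν => ?_)
  · by_contra hν'
    exact hcon (key E E' (congrFun hEE') ν hν hν')
  · by_contra hν'
    exact hcon (key E' E (fun t => (congrFun hEE' t).symm) ν hν hν')

/-- A direct summand of an `ℵ₁`-projective module that is countably generated is a direct summand
of a projective submodule. -/
theorem projective_of_retract_alephOneProjective {A B : ModuleCat.{u} Rᵐᵒᵖ} {b : ℕ → B}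
    (hb : IsTelescope a b) (hA : AlephOneProjective R A) (f : A →ₗ[Rᵐᵒᵖ] B) (g : B →ₗ[Rᵐᵒᵖ] A)
    (hfg : ∀ x, f (g x) = x) : Module.Projective Rᵐᵒᵖ B := by
  obtain ⟨S, hS⟩ := hA
  obtain ⟨N, hN, hle⟩ := hS.exists_le (Set.range fun n => g (b n)) (Set.countable_range _)
  have := hS.projective N hN
  have hgN : ∀ x, g x ∈ N := by
    intro x
    obtain ⟨n, r, rfl⟩ := hb.exists_eq x
    rw [map_smul]
    exact N.smul_mem r (hle ⟨n, rfl⟩)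
  exact Module.Projective.of_split (g.codRestrict N hgN) (f ∘ₗ N.subtype)
    (LinearMap.ext fun x => hfg x)

theorem projective_of_retract_FM {A B : ModuleCat.{u} Rᵐᵒᵖ} {b : ℕ → B}
    (hb : IsTelescope a b) (hA : FM R A) (f : A →ₗ[Rᵐᵒᵖ] B) (g : B →ₗ[Rᵐᵒᵖ] A)
    (hfg : ∀ x, f (g x) = x) : Module.Projective Rᵐᵒᵖ B :=
  hb.projective_of_isMittagLeffler (FM_of_retract hA g f hfg).2

theorem not_hasPrecover_alephOneProjective {B : ModuleCat.{u} Rᵐᵒᵖ} (hB : IsBass R B)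
    (hproj : ¬ Module.Projective Rᵐᵒᵖ B) : ¬ HasPrecover (AlephOneProjective R) B := by
  rintro ⟨A, f, hA, hf⟩
  obtain ⟨a, b, hb⟩ := hB.exists_isTelescope
  obtain ⟨g, hg⟩ := exists_section_of_treeModule_lift hb f fun K _ f' =>
    hf (ModuleCat.of Rᵐᵒᵖ (treeModule a K)) (alephOneProjective_treeModule a K) f'
  exact hproj (projective_of_retract_alephOneProjective hb hA f g hg)

theorem not_hasPrecover_FM {B : ModuleCat.{u} Rᵐᵒᵖ} (hB : IsBass R B)
    (hproj : ¬ Module.Projective Rᵐᵒᵖ B) : ¬ HasPrecover (FM R) B := by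
  rintro ⟨A, f, hA, hf⟩
  obtain ⟨a, b, hb⟩ := hB.exists_isTelescope
  obtain ⟨g, hg⟩ := exists_section_of_treeModule_lift hb f fun K _ f' =>
    hf (ModuleCat.of Rᵐᵒᵖ (treeModule a K)) (FM_treeModule a K) f'
  exact hproj (projective_of_retract_FM hb hA f g hg)

end NoPrecover

/-! ### The flat Mittag-Leffler modules are not deconstructible -/

section Closure

theorem mk_iUnion_le_of_le {ι : Type v} {α : Type u} {κ : Cardinal.{u}} (hκ : ℵ₀ ≤ κ)
    (hι : lift.{u} #ι ≤ lift.{v} κ) {f : ι → Set α} (hf : ∀ i, #(f i) ≤ κ) : #(⋃ i, f i) ≤ κ := by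
  rw [← lift_le.{v}]
  refine mk_iUnion_le_sum_mk_lift.trans ((sum_le_sum _ (fun _ => κ) hf).trans ?_)
  rw [sum_const]
  exact mul_le_of_le (aleph0_le_lift.2 hκ) hι le_rfl

variable {A : Type u} [Ring A] {L : Type u} [AddCommGroup L] [Module A L] {κ : Cardinal.{u}}

theorem mk_span_le (hκ : ℵ₀ ≤ κ) (hA : #A ≤ κ) {s : Set L} (hs : #s ≤ κ) :
    #(Submodule.span A s) ≤ κ := by
  classical
  have h1 : #(Submodule.span A s) ≤ #(s →₀ A) := by
    refine mk_le_of_surjective (f := fun l => ⟨Finsupp.linearCombination A (Subtype.val : s → L) l,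
      (Finsupp.mem_span_iff_linearCombination A s _).2 ⟨l, rfl⟩⟩) fun x => ?_
    obtain ⟨l, hl⟩ := (Finsupp.mem_span_iff_linearCombination A s _).1 x.2
    exact ⟨l, Subtype.ext hl⟩
  have h2 : #(s →₀ A) ≤ #(List (s × A)) :=
    (mk_le_of_injective (Finsupp.graph_injective s A)).trans
      (mk_le_of_surjective List.toFinset_surjective)
  refine (h1.trans h2).trans ((mk_list_le_max _).trans (max_le hκ ?_))
  rw [mk_prod, lift_id, lift_id]
  exact mul_le_of_le hκ hs hA

/-- The Löwenheim–Skolem argument: a small set of elements is contained in a small submodule that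
contains with each element `x` the small set `r x`. -/
theorem exists_small_closed_submodule (hκ : ℵ₀ ≤ κ) (hA : #A ≤ κ) {D : Set L} (hD : #D ≤ κ)
    {r : L → Set L} (hr : ∀ x, #(r x) ≤ κ) :
    ∃ N : Submodule A L, D ⊆ N ∧ (∀ x ∈ N, r x ⊆ N) ∧ #N ≤ κ := by
  let step : Submodule A L → Submodule A L := fun N => Submodule.span A (N ∪ ⋃ x : N, r x)
  let G : ℕ → Submodule A L := fun n => step^[n] (Submodule.span A D)
  have hG : ∀ n, G (n + 1) = Submodule.span A (G n ∪ ⋃ x : G n, r x) := fun n =>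
    Function.iterate_succ_apply' step n _
  have hmono : Monotone G := monotone_nat_of_le_succ fun n => by
    rw [hG]; exact Set.subset_union_left.trans Submodule.subset_span
  have hcard : ∀ n, #(G n) ≤ κ := by
    intro n
    induction n with
    | zero => exact mk_span_le hκ hA hD
    | succ n ih =>
      rw [hG]
      refine mk_span_le hκ hA ((mk_union_le _ _).trans (add_le_of_le hκ ih ?_))
      exact mk_iUnion_le_of_le hκ (by simpa using ih) fun x => hr x
  have hcoe : ((⨆ n, G n : Submodule A L) : Set L) = ⋃ n, (G n : Set L) :=
    Submodule.coe_iSup_of_directed G hmono.directed_le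
  refine ⟨⨆ n, G n, fun x hx => ?_, fun x hx y hy => ?_, ?_⟩
  · exact Submodule.mem_iSup_of_mem 0 (Submodule.subset_span hx)
  · obtain ⟨n, hn⟩ := (Submodule.mem_iSup_of_directed G hmono.directed_le).1 hx
    refine Submodule.mem_iSup_of_mem (n + 1) ?_
    rw [hG]
    exact Submodule.subset_span (Or.inr (Set.mem_iUnion.2 ⟨⟨x, hn⟩, hy⟩))
  · have : #((⨆ n, G n : Submodule A L) : Set L) ≤ κ := by
      rw [hcoe]
      exact mk_iUnion_le_of_le hκ (by simpa using hκ) hcard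
    exact this

end Closure

section Filtration

theorem nonempty_quotient_equiv {A G H : Type*} [Ring A] [AddCommGroup G] [Module A G]
    [AddCommGroup H] [Module A H] {N : Submodule A G} (ψ : G →ₗ[A] H) (hψ : Function.Surjective ψ)
    (hN : ∀ x, ψ x = 0 ↔ x ∈ N) : Nonempty ((G ⧸ N) ≃ₗ[A] H) :=
  ⟨(Submodule.quotEquivOfEq _ _ (Submodule.ext fun x => (hN x).symm)).trans
    (ψ.quotKerEquivOfSurjective hψ)⟩

variable {R : Type u} [Ring R] {L : ModuleCat.{u} Rᵐᵒᵖ}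

/-- If the submodule `N` of the filtered module `L` contains, at each step at which it grows, a
representative of every coset, then each factor of the filtration of `L` is a factor of one of the
filtrations induced on `N` and on `L ⧸ N`, while it becomes zero in the other. So `(L ⧸ N) × N` has
a filtration with the same factors as `L`; in `L ⧸ N` alone zero factors would occur. -/
theorem isFiltered_quotient_prod {C : ModuleCat.{u} Rᵐᵒᵖ → Prop} {σ : Ordinal.{u}}
    {F : Ordinal.{u} → Submodule Rᵐᵒᵖ L} (hmono : ∀ α β, α ≤ β → β ≤ σ → F α ≤ F β)
    (h0 : F 0 = ⊥) (hlim : ∀ α ≤ σ, Order.IsSuccLimit α → F α = ⨆ β : Set.Iio α, F β)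
    (hsucc : ∀ α < σ, ∃ X : ModuleCat.{u} Rᵐᵒᵖ, C X ∧
      Nonempty ((F (Order.succ α) ⧸ (F α).submoduleOf (F (Order.succ α))) ≃ₗ[Rᵐᵒᵖ] X))
    (hσ : F σ = ⊤) (N : Submodule Rᵐᵒᵖ L)
    (hN : ∀ α < σ, ∀ x ∈ N, x ∈ F (Order.succ α) → x ∉ F α →
      ∀ y ∈ F (Order.succ α), ∃ z ∈ N, z ∈ F (Order.succ α) ∧ y - z ∈ F α) :
    IsFiltered C (ModuleCat.of Rᵐᵒᵖ ((L ⧸ N) × N)) := by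
  let F' : Ordinal.{u} → Submodule Rᵐᵒᵖ ((L ⧸ N) × N) := fun α =>
    ((F α).map N.mkQ).prod ((F α).comap N.subtype)
  have hF' : ∀ α (x : L) (y : N), x ∈ F α → (y : L) ∈ F α → (N.mkQ x, y) ∈ F' α :=
    fun α x y hx hy => ⟨⟨x, hx, rfl⟩, hy⟩
  have hmono' : ∀ α β, α ≤ β → β ≤ σ → F' α ≤ F' β := fun α β h h' =>
    Submodule.prod_mono (Submodule.map_mono (hmono α β h h'))
      (Submodule.comap_mono (hmono α β h h'))
  refine ⟨σ, F', hmono', ?_, fun α hα hαlim => ?_, fun α hα => ?_, ?_⟩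
  · simp only [F', h0, Submodule.map_bot, Submodule.comap_bot, Submodule.ker_subtype,
      Submodule.prod_bot]
  · refine le_antisymm ?_ (iSup_le fun β => hmono' _ _ (le_of_lt β.2) hα)
    have hne : Nonempty (Set.Iio α) := by
      obtain ⟨β, hβ⟩ := not_isMin_iff.1 hαlim.not_isMin
      exact ⟨β, hβ⟩
    have hdir : Directed (· ≤ ·) fun β : Set.Iio α => F β := by
      intro β γ
      rcases le_total β.1 γ.1 with h | h
      · exact ⟨γ, hmono _ _ h (γ.2.le.trans hα), le_rfl⟩
      · exact ⟨β, le_rfl, hmono _ _ h (β.2.le.trans hα)⟩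
    rintro ⟨_, y⟩ ⟨⟨x, hx, rfl⟩, hy⟩
    replace hy : (y : L) ∈ F α := hy
    replace hx : x ∈ F α := hx
    rw [hlim α hα hαlim, Submodule.mem_iSup_of_directed _ hdir] at hx hy
    obtain ⟨β, hβ⟩ := hx
    obtain ⟨γ, hγ⟩ := hy
    rcases le_total β.1 γ.1 with h | h
    · exact Submodule.mem_iSup_of_mem γ (hF' _ _ _ (hmono _ _ h (γ.2.le.trans hα) hβ) hγ)
    · exact Submodule.mem_iSup_of_mem β (hF' _ _ _ hβ (hmono _ _ h (β.2.le.trans hα) hγ))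
  · obtain ⟨X, hX, ⟨e⟩⟩ := hsucc α hα
    refine ⟨X, hX, ?_⟩
    suffices h : Nonempty ((F' (Order.succ α) ⧸ (F' α).submoduleOf (F' (Order.succ α))) ≃ₗ[Rᵐᵒᵖ]
        (F (Order.succ α) ⧸ (F α).submoduleOf (F (Order.succ α)))) from h.map fun e' => e'.trans e
    by_cases hgrow : ∃ x ∈ N, x ∈ F (Order.succ α) ∧ x ∉ F α
    -- `N` grows: the factor of `L ⧸ N` is zero and that of `N` is the given one
    · obtain ⟨x, hx, hx1, hx2⟩ := hgrow
      have hrep := hN α hα x hx hx1 hx2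
      let ψ : F' (Order.succ α) →ₗ[Rᵐᵒᵖ]
          (F (Order.succ α) ⧸ (F α).submoduleOf (F (Order.succ α))) :=
        Submodule.mkQ _ ∘ₗ ((N.subtype ∘ₗ LinearMap.snd _ _ _) ∘ₗ (F' _).subtype).codRestrict
          (F (Order.succ α)) fun z => z.2.2
      refine nonempty_quotient_equiv ψ (fun y => ?_) fun z => ?_
      · obtain ⟨⟨y, hy⟩, rfl⟩ := Submodule.Quotient.mk_surjective _ y
        obtain ⟨z, hzN, hz, hyz⟩ := hrep y hy
        refine ⟨⟨(N.mkQ 0, ⟨z, hzN⟩), hF' _ _ _ (zero_mem _) hz⟩, ?_⟩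
        refine (Submodule.Quotient.eq _).2 ?_
        change z - y ∈ F α
        rw [← neg_sub]
        exact neg_mem hyz
      · obtain ⟨⟨w, y⟩, hz⟩ := z
        obtain ⟨⟨x', hx', hw⟩, -⟩ := id hz
        change N.mkQ x' = w at hw
        subst hw
        refine (Submodule.Quotient.mk_eq_zero _).trans
          ⟨fun h => ⟨?_, h⟩, fun h => h.2⟩
        obtain ⟨z, hzN, hz, hyz⟩ := hrep x' hx'
        refine ⟨x' - z, hyz, ?_⟩
        rw [map_sub]
        have : N.mkQ z = 0 := (Submodule.Quotient.mk_eq_zero N).2 hzN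
        rw [this, sub_zero]
        rfl
    -- `N` does not grow: its factor is zero and that of `L ⧸ N` is the given one
    · have hsub : ∀ x ∈ N, x ∈ F (Order.succ α) → x ∈ F α := by
        intro x hx hx1
        by_contra hx2
        exact hgrow ⟨x, hx, hx1, hx2⟩
      have hle : F α ≤ F (Order.succ α) := hmono _ _ (Order.le_succ α) (Order.succ_le_of_lt hα)
      let ψ : F (Order.succ α) →ₗ[Rᵐᵒᵖ]
          (F' (Order.succ α) ⧸ (F' α).submoduleOf (F' (Order.succ α))) :=
        Submodule.mkQ _ ∘ₗ ((LinearMap.inl Rᵐᵒᵖ (L ⧸ N) N ∘ₗ N.mkQ) ∘ₗ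
          (F _).subtype).codRestrict (F' (Order.succ α)) fun z => hF' _ _ _ z.2 (zero_mem _)
      refine (nonempty_quotient_equiv ψ (fun y => ?_) fun z => ?_).map LinearEquiv.symm
      · obtain ⟨⟨⟨w, y⟩, hz⟩, rfl⟩ := Submodule.Quotient.mk_surjective _ y
        obtain ⟨⟨x, hx, hw⟩, hy⟩ := id hz
        change N.mkQ x = w at hw
        subst hw
        refine ⟨⟨x, hx⟩, (Submodule.Quotient.eq _).2 ?_⟩
        refine ⟨⟨0, zero_mem _, ?_⟩, ?_⟩
        · change N.mkQ 0 = N.mkQ x - N.mkQ x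
          rw [sub_self, map_zero]
        · change ((0 - y : N) : L) ∈ F α
          rw [zero_sub]
          exact neg_mem (hsub _ y.2 hy)
      · obtain ⟨z, hz⟩ := z
        refine (Submodule.Quotient.mk_eq_zero _).trans ⟨fun h => ?_, fun h => ?_⟩
        · obtain ⟨⟨x, hx, hxz⟩, -⟩ := h
          have hxz' : x - z ∈ N := (Submodule.Quotient.eq N).1 hxz
          have := hsub _ hxz' (sub_mem (hle hx) hz)
          change z ∈ F α
          rw [← sub_sub_cancel x z]
          exact sub_mem hx this
        · exact hF' _ _ _ h (zero_mem _)
  · simp only [F', hσ, Submodule.map_top, Submodule.range_mkQ, Submodule.comap_top,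
      Submodule.prod_top]

end Filtration

section NotDeconstructible

variable {R : Type u} [Ring R]

/-- If the flat Mittag-Leffler modules were the modules filtered by a set of them, then a tree
module `L` for large `K` would contain a submodule `N` with at most `#K` elements that contains all
nodes and for which `(L ⧸ N) × N` is flat Mittag-Leffler. As there are more than `#K` branches, the
projection on one of them vanishes on `N`, so that the Bass module `B` is a direct summand of
`L ⧸ N`, hence projective. -/
theorem not_isDeconstructible_FM (hR : ¬ IsRightPerfect R) : ¬ IsDeconstructible (FM R) := by
  classical
  rintro ⟨ι, D, -, hD⟩
  obtain ⟨B, hB, hproj⟩ := exists_isBass_not_projective hR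
  obtain ⟨a, b, hb⟩ := hB.exists_isTelescope
  obtain ⟨K, hK, hXK, hKK⟩ := exists_set_embedding_seq ((Σ i, D i) ⊕ Rᵐᵒᵖ)
  have hKne : Nonempty K := by
    rw [← mk_ne_zero_iff]; exact (aleph0_pos.trans_le hK).ne'
  have hKinf : Infinite K := aleph0_le_mk_iff.1 hK
  have hAK : #Rᵐᵒᵖ ≤ #K := (mk_le_of_injective Sum.inr_injective).trans hXK
  have hDK : ∀ i, #(D i) ≤ #K := fun i => (mk_le_of_injective (Sum.inl_injective.comp
    (sigma_mk_injective (β := fun i => (D i : Type u)) (i := i)))).trans hXK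
  obtain ⟨σ, F, hmono, h0, hlim, hsucc, hσ⟩ :=
    (hD (ModuleCat.of Rᵐᵒᵖ (treeModule a K))).1 (FM_treeModule a K)
  -- a small set of representatives of the cosets in each factor of the filtration
  have hG : ∀ α, ∃ G : Set (treeModule a K), #G ≤ #K ∧ (α < σ → ∀ y ∈ F (Order.succ α),
      ∃ z ∈ G, z ∈ F (Order.succ α) ∧ y - z ∈ F α) := by
    intro α
    by_cases hα : α < σ
    · obtain ⟨C, ⟨i, rfl⟩, ⟨e⟩⟩ := hsucc α hα
      refine ⟨Set.range fun q : D i => ((e.symm q).out : F (Order.succ α)).1,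
        mk_range_le.trans (hDK i), fun _ y hy => ?_⟩
      refine ⟨_, ⟨e (Submodule.Quotient.mk ⟨y, hy⟩), rfl⟩, Subtype.prop _, ?_⟩
      beta_reduce
      rw [e.symm_apply_apply]
      have h1 := (Submodule.Quotient.eq ((F α).submoduleOf (F (Order.succ α)))).1
        (Quotient.out_eq (Submodule.Quotient.mk (p := (F α).submoduleOf (F (Order.succ α)))
          ⟨y, hy⟩)).symm
      exact h1
    · exact ⟨∅, by simp, fun h => absurd h hα⟩
  choose G hGK hG using hG
  have hr : ∀ x : treeModule a K, ∃ r : Set (treeModule a K), #r ≤ #K ∧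
      ∀ α < σ, x ∈ F (Order.succ α) → x ∉ F α → G α ⊆ r := by
    intro x
    by_cases hx : ∃ α < σ, x ∈ F (Order.succ α) ∧ x ∉ F α
    · obtain ⟨α, hα, hx1, hx2⟩ := hx
      refine ⟨G α, hGK α, fun β hβ hy1 hy2 => ?_⟩
      rcases lt_trichotomy α β with h | rfl | h
      · exact absurd (hmono _ _ (Order.succ_le_of_lt h) hβ.le hx1) hy2
      · exact subset_rfl
      · exact absurd (hmono _ _ (Order.succ_le_of_lt h) hα.le hy1) hx2
    · exact ⟨∅, by simp, fun α hα h1 h2 => absurd ⟨α, hα, h1, h2⟩ hx⟩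
  choose r hrK hr using hr
  obtain ⟨N, hnodes, hNr, hNK⟩ := exists_small_closed_submodule (A := Rᵐᵒᵖ) hK hAK
    (D := Set.range (treeNode a)) (mk_range_le.trans (mk_list_eq_mk K).le) hrK
  have hFM : FM R (ModuleCat.of Rᵐᵒᵖ ((treeModule a K ⧸ N) × N)) :=
    (hD _).2 (isFiltered_quotient_prod (L := ModuleCat.of Rᵐᵒᵖ (treeModule a K)) hmono h0 hlim hsucc
      hσ N fun α hα x hxN hx1 hx2 y hy => by
        obtain ⟨z, hz, hz'⟩ := hG α hα y hy
        exact ⟨z, hNr x hxN (hr x α hα hx1 hx2 hz), hz'⟩)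
  -- the projections on the branches, and a branch on which `N` projects to zero
  choose h hnode hbranch using fun ν : ℕ → K =>
    exists_treeModule_hom a (s := fun μ n => if μ = ν then b n else 0) fun μ n => by
      split_ifs
      · exact hb.eq_smul n
      · simp
  have hfin : ∀ x, {ν | h ν x ≠ 0}.Finite := by
    let N' : Submodule Rᵐᵒᵖ (treeModule a K) :=
      { carrier := {x | {ν | h ν x ≠ 0}.Finite}
        zero_mem' := by simp
        add_mem' := fun {x y} hx hy => (hx.union hy).subset fun ν hν => by
          by_contra hcon
          simp only [Set.mem_union, Set.mem_ofPred_eq, not_or, not_not] at hcon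
          exact hν (by rw [map_add, hcon.1, hcon.2, add_zero])
        smul_mem' := fun c x hx => Set.Finite.subset hx fun ν hν hcon => hν (by
          rw [map_smul, hcon, smul_zero]) }
    have : N' = ⊤ := treeModule_le a (fun t => by simp [N', hnode]) fun ν n =>
      (Set.finite_singleton ν).subset fun μ hμ => by
        by_contra hne
        exact hμ (by rw [hbranch, if_neg (Ne.symm hne)])
    exact fun x => this.ge (Submodule.mem_top (x := x))
  obtain ⟨ν, hν⟩ : ∃ ν, ∀ x ∈ N, h ν x = 0 := by
    by_contra! hcon
    have hunion : ⋃ x : N, {ν | h ν x ≠ 0} = Set.univ := Set.eq_univ_of_forall fun ν => by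
      obtain ⟨x, hx, hνx⟩ := hcon ν
      exact Set.mem_iUnion.2 ⟨⟨x, hx⟩, hνx⟩
    have := mk_iUnion_le_of_le (f := fun x : N => {ν | h ν x ≠ 0}) hK (by simpa using hNK)
      fun x => ((hfin x).lt_aleph0.le).trans hK
    rw [hunion, mk_univ] at this
    exact (cantor #K).not_ge (mk_set.symm.le.trans (hKK.trans this))
  obtain ⟨g, hg⟩ := hb.exists_lift (M := (treeModule a K ⧸ N) × N)
    (s := fun n => (Submodule.Quotient.mk (treeBranch a ν n), 0)) fun n => by
      rw [treeBranch_eq, Submodule.Quotient.mk_add, Submodule.Quotient.mk_smul,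
        (Submodule.Quotient.mk_eq_zero N).2 (hnodes ⟨_, rfl⟩), zero_add, Prod.smul_mk, smul_zero]
  refine hproj (projective_of_retract_FM hb hFM (N.liftQ (h ν) hν ∘ₗ LinearMap.fst _ _ _) g fun x =>
    LinearMap.congr_fun (f := (N.liftQ (h ν) hν ∘ₗ LinearMap.fst _ _ _) ∘ₗ g) (g := LinearMap.id)
      (hb.hom_ext fun n => ?_) x)
  rw [LinearMap.comp_apply, hg]
  change h ν (treeBranch a ν n) = b n
  rw [hbranch, if_pos rfl]

end NotDeconstructible

end RightMod

theorem theorem1 (R : Type u) [Ring R] (hR : ¬ RightMod.IsRightPerfect R) :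
    (∀ B : ModuleCat.{u} Rᵐᵒᵖ, RightMod.IsBass R B → ¬ Module.Projective Rᵐᵒᵖ B →
      ¬ RightMod.HasPrecover (RightMod.AlephOneProjective R) B ∧
      ¬ RightMod.HasPrecover (RightMod.FM R) B) ∧
    ¬ RightMod.IsPrecovering (RightMod.FM R) ∧
    ¬ RightMod.IsDeconstructible (RightMod.FM R) := by
  refine ⟨fun B hB hproj => ⟨RightMod.not_hasPrecover_alephOneProjective hB hproj,
    RightMod.not_hasPrecover_FM hB hproj⟩, fun h => ?_, RightMod.not_isDeconstructible_FM hR⟩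
  obtain ⟨B, hB, hproj⟩ := RightMod.exists_isBass_not_projective hR
  exact RightMod.not_hasPrecover_FM hB hproj (h B)
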